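/- Let $\Omega\subset\mathbb R^n$ be an open set which is bounded in one direction (it lies between two parallel hyperplanes), let $0<s<1$, and let $W\subset\Omega_e:=\mathbb R^n\setminus\overline\Omega$ be a nonempty open set. Let $\nabla^s u(x,y)=\sqrt{C_{n,s}/2}\,\frac{u(x)-u(y)}{|x-y|^{n/2+s+1}}(x-y)$ with $C_{n,s}=\frac{4^s\Gamma(n/2+s)}{\pi^{n/2}|\Gamma(-s)|}$. For a conductivity $\gamma\in L^\infty(\mathbb R^n)$ with $\gamma\ge\gamma_0$ a.e. for some constant $\gamma_0>0$, let $$B_\gamma(u,v)=\int_{\mathbb R^{2n}}\gamma^{1/2}(x)\gamma^{1/2}(y)\,\nabla^su\cdot\nabla^sv\,dx\,dy,\qquad \langle\Lambda_\gamma f,g\rangle=B_\gamma(u_f,g)\qquad(f,g\in H^s(\mathbb R^n)),$$ where $u_f\in H^s(\mathbb R^n)$ is the unique function with $u_f-f\in\widetilde H^s(\Omega)$ (the closure of $C_c^\infty(\Omega)$ in $H^s(\mathbb R^n)$) and $B_\gamma(u_f,\phi)=0$ for all $\phi\in\widetilde H^s(\Omega)$. No Sobolev regularity of the conductivities is assumed.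 1. (Exterior determination.) Let $\gamma_1,\gamma_2$ be conductivities as above which (for suitable representatives) are continuous at a.e. point of $W$. If $\Lambda_{\gamma_1}f|_W=\Lambda_{\gamma_2}f|_W$ for all $f\in C_c^\infty(W)$, that is, $\langle\Lambda_{\gamma_1}f,g\rangle=\langle\Lambda_{\gamma_2}f,g\rangle$ for all $f,g\in C_c^\infty(W)$, then $\gamma_1=\gamma_2$ a.e. in $W$. 2. (Reconstruction.) For every $x_0\in W$ there is a sequence $(\phi_N)_{N\in\mathbb N}\subset C_c^\infty(W)$, which does not depend on the conductivity, such that $\|\phi_N\|_{L^2(\mathbb R^n)}^2+\|\nabla^s\phi_N\|_{L^2(\mathbb R^{2n})}^2=1$ for all $N$, $\|\phi_N\|_{L^2(\mathbb R^n)}\to0$, the supports of $\phi_N$ shrink to $\{x_0\}$, and $$\gamma(x_0)=\lim_{N\to\infty}\langle\Lambda_\gamma\phi_N,\phi_N\rangle$$ for every conductivity $\gamma$ as above that is continuous at $x_0$. In particular, if $\gamma$ is continuous a.e. in $W$, this holds for a.e. $x_0\in W$. -/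

import Mathlib

open MeasureTheory Filter TopologicalSpace
open scoped ENNReal Topology FourierTransform Distributions

noncomputable section

namespace FracCond

/-- Euclidean space `ℝⁿ`. -/
abbrev Rn (n : ℕ) : Type := EuclideanSpace ℝ (Fin n)

/-- Real-valued `L²(ℝⁿ)` (functions up to equality a.e.). -/
abbrev L2 (n : ℕ) : Type := Lp ℝ 2 (volume : Measure (Rn n))

/-- A test function `φ ∈ C_c^∞(U)` (`𝓓(U, ℝ)` is Mathlib's space of smooth real functions on `ℝⁿ`
with compact support contained in the open set `U`), seen as an element of `L²(ℝⁿ)`. -/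
def testL2 {n : ℕ} {U : Opens (Rn n)} (φ : 𝓓(U, ℝ)) : L2 n :=
  (φ.continuous.memLp_of_hasCompactSupport (p := 2) (μ := volume) φ.hasCompactSupport).toLp φ

/-- The Fourier transform of a real-valued `L²` function, with Mathlib's normalization
`∫ u(x) exp(-2πi x·ξ) dx`. -/
def fourierL2 {n : ℕ} (u : L2 n) : Lp ℂ 2 (volume : Measure (Rn n)) :=
  𝓕 (Complex.ofRealCLM.compLp u)

/-- The Bessel potential norm `‖⟨D⟩^s u‖_{L²}` of `u ∈ L²(ℝⁿ)`, valued in `[0, ∞]`. It is computed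
on the Fourier side (Plancherel); with the normalization of `fourierL2` the symbol of
`⟨D⟩^s = (1 - Δ)^{s/2}` is `(1 + |2πξ|²)^{s/2}`. -/
def hsNorm {n : ℕ} (s : ℝ) (u : L2 n) : ℝ≥0∞ :=
  eLpNorm (fun ξ : Rn n => ((1 + (2 * Real.pi * ‖ξ‖) ^ 2) ^ (s / 2) : ℝ) • fourierL2 u ξ) 2 volume

/-- `u ∈ H^s(ℝⁿ)`, where `s ≥ 0` (so that `H^s ⊆ L²`). -/
def MemHs {n : ℕ} (s : ℝ) (u : L2 n) : Prop :=
  hsNorm s u < ⊤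

/-- `u ∈ H̃^s(Ω)`, the closure of `C_c^∞(Ω)` in `H^s(ℝⁿ)`. -/
def MemHsTilde {n : ℕ} (Ω : Opens (Rn n)) (s : ℝ) (u : L2 n) : Prop :=
  MemHs s u ∧ ∀ ε : ℝ≥0∞, 0 < ε → ∃ φ : 𝓓(Ω, ℝ), hsNorm s (u - testL2 φ) < ε

/-- The constant `C_{n,s} = 4^s Γ(n/2 + s) / (π^{n/2} |Γ(-s)|)` of the fractional Laplacian. -/
def fracConst (n : ℕ) (s : ℝ) : ℝ :=
  (4 : ℝ) ^ s * Real.Gamma ((n : ℝ) / 2 + s) /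
    (Real.pi ^ ((n : ℝ) / 2) * |Real.Gamma (-s)|)

/-- The fractional gradient
`∇^s u (x, y) = √(C_{n,s} / 2) (u(x) - u(y)) / |x - y|^{n/2 + s + 1} (x - y)`. -/
def fracGrad {n : ℕ} (s : ℝ) (u : L2 n) (p : Rn n × Rn n) : Rn n :=
  (√(fracConst n s / 2) * ((u p.1 - u p.2) / ‖p.1 - p.2‖ ^ ((n : ℝ) / 2 + s + 1))) • (p.1 - p.2)

/-- The bilinear form
`B_γ(u, v) = ∫_{ℝ²ⁿ} γ^{1/2}(x) γ^{1/2}(y) ∇^s u (x, y) · ∇^s v (x, y) dx dy`. -/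
def condForm {n : ℕ} (s : ℝ) (γ : Rn n → ℝ) (u v : L2 n) : ℝ :=
  ∫ p : Rn n × Rn n, √(γ p.1) * √(γ p.2) * inner ℝ (fracGrad s u p) (fracGrad s v p)

/-- `u` is a weak solution of the fractional conductivity equation
`div_s (Θ_γ ∇^s u) = 0` in `Ω`, `u = f` in `Ω_e`. -/
def IsWeakSolution {n : ℕ} (Ω : Opens (Rn n)) (s : ℝ) (γ : Rn n → ℝ) (f u : L2 n) : Prop :=
  MemHs s u ∧ MemHsTilde Ω s (u - f) ∧ ∀ φ : L2 n, MemHsTilde Ω s φ → condForm s γ u φ = 0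

open Classical in
/-- The exterior Dirichlet-to-Neumann map as a pairing: `⟨Λ_γ f, g⟩ = B_γ(u_f, g)`, where `u_f` is
the weak solution with exterior value `f`. (For `Ω` bounded in one direction, `0 < s < 1`, a
uniformly elliptic `γ` and `f ∈ H^s(ℝⁿ)` this solution exists and is unique; the value `0` in the
absence of a solution plays no role.) -/
def dnMap {n : ℕ} (Ω : Opens (Rn n)) (s : ℝ) (γ : Rn n → ℝ) (f g : L2 n) : ℝ :=
  if h : ∃ u : L2 n, IsWeakSolution Ω s γ f u then condForm s γ h.choose g else 0

/-- A set is bounded in one direction if it lies between two parallel hyperplanes. -/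
def BoundedInOneDirection {n : ℕ} (Ω : Set (Rn n)) : Prop :=
  ∃ v : Rn n, ‖v‖ = 1 ∧ ∃ a b : ℝ, ∀ x ∈ Ω, a ≤ inner ℝ v x ∧ inner ℝ v x ≤ b

/-- `γ ∈ L^∞(ℝⁿ)` with `γ ≥ γ₀ > 0` a.e. for some constant `γ₀`. -/
def IsConductivity {n : ℕ} (γ : Rn n → ℝ) : Prop :=
  MemLp γ ⊤ volume ∧ ∃ γ₀ : ℝ, 0 < γ₀ ∧ ∀ᵐ x, γ₀ ≤ γ x

/-- Test functions `φ N ∈ C_c^∞(W)` whose energy concentrates at `x₀`: they are normalized by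
`‖φ N‖²_{L²} + ‖∇^s φ N‖²_{L²} = 1`, tend to `0` in `L²`, and their supports shrink to `{x₀}`. -/
structure ConcentratesAt {n : ℕ} {W : Opens (Rn n)} (s : ℝ) (φ : ℕ → 𝓓(W, ℝ)) (x₀ : Rn n) :
    Prop where
  normalized : ∀ N, eLpNorm (φ N) 2 volume ^ 2 + eLpNorm (fracGrad s (testL2 (φ N))) 2 volume ^ 2 = 1
  tendsto_zero : Tendsto (fun N => eLpNorm (φ N) 2 volume) atTop (𝓝 0)
  support_shrinks : ∀ ε : ℝ, 0 < ε → ∀ᶠ N in atTop, tsupport (φ N) ⊆ Metric.ball x₀ ε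

end FracCond

end

/-!
By Plancherel, `‖u‖² + ‖∇^s u‖²` is an equivalent norm on `H^s`. A function supported in a slab of
width `ε` satisfies `‖u‖ ≤ C ε^s ‖∇^s u‖`: translating it across the slab by more than `ε` moves
the support off itself, and `∇^s u` controls the `L²` norms of the differences of `u` and its
translates. With `Ω` inside a slab, this makes `B_γ` coercive on `H̃^s(Ω)`, so `u_f` exists, and
`⟨Λ_γ f, f⟩ = B_γ(f, f) + B_γ(u_f - f, f)`.

If `f` is supported at a positive distance from `Ω`, then only the integrable tail of the kernel
enters `B_γ(u_f - f, f)`, which by coercivity is `O(‖f‖²)` in terms of the `L²` norm of `f`. If `f`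
is supported near a continuity point `x₀` of `γ`, then the weight `γ^{1/2}(x) γ^{1/2}(y)` is close
to `γ(x₀)` near `(x₀, x₀)`, and away from `(x₀, x₀)` again only the tail contributes, so that
`B_γ(f, f) = γ(x₀) ‖∇^s f‖² + o(‖∇^s f‖²) + O(‖f‖²)`. Normalized test functions with
supports shrinking to `x₀` tend to `0` in `L²` by the slab inequality; along them
`⟨Λ_γ f, f⟩ → γ(x₀)`.
-/

namespace FracCond

open scoped NNReal SchwartzMap RealInnerProductSpace

section Lebesgue

variable {α E F : Type*} [MeasurableSpace α] [NormedAddCommGroup E] [NormedAddCommGroup F]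
  {μ : Measure α}

theorem eLpNorm_two_sq (f : α → E) : eLpNorm f 2 μ ^ 2 = ∫⁻ x, ‖f x‖ₑ ^ 2 ∂μ := by
  simpa using eLpNorm_nnreal_pow_eq_lintegral (μ := μ) (f := f) (p := 2) (by norm_num)

theorem lintegral_enorm_mul_enorm_le {f : α → E} {g : α → F} (hf : AEStronglyMeasurable f μ)
    (hg : AEStronglyMeasurable g μ) :
    ∫⁻ x, ‖f x‖ₑ * ‖g x‖ₑ ∂μ ≤ eLpNorm f 2 μ * eLpNorm g 2 μ := by
  simpa [eLpNorm_eq_lintegral_rpow_enorm_toReal] using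
    ENNReal.lintegral_mul_le_Lp_mul_Lq μ Real.HolderConjugate.two_two hf.enorm hg.enorm

end Lebesgue

section Translation

variable {G E F : Type*} [AddCommGroup G] [MeasurableSpace G] [MeasurableAdd₂ G] [MeasurableNeg G]
  [NormedAddCommGroup E] [NormedAddCommGroup F] {μ : Measure G} [SFinite μ] [μ.IsAddLeftInvariant]

theorem lintegral_prod_sub {Φ : G × G → ℝ≥0∞} (hΦ : Measurable Φ) :
    ∫⁻ p, Φ (p.1 - p.2, p.2) ∂μ.prod μ = ∫⁻ h, ∫⁻ y, Φ (h, y) ∂μ ∂μ := by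
  rw [(measurePreserving_sub_prod μ μ).lintegral_comp hΦ, lintegral_prod _ hΦ.aemeasurable]

omit [MeasurableNeg G] [SFinite μ] in
theorem eLpNorm_comp_add_left {u : G → E} (hu : AEStronglyMeasurable u μ) (h : G) :
    eLpNorm (fun y => u (h + y)) 2 μ = eLpNorm u 2 μ :=
  eLpNorm_comp_measurePreserving hu (measurePreserving_add_left μ h)

theorem lintegral_convolution_le {k : G → ℝ≥0∞} (hk : Measurable k) {u : G → E} {v : G → F}
    (hu : StronglyMeasurable u) (hv : StronglyMeasurable v) :
    ∫⁻ p, k (p.1 - p.2) * (‖u p.1‖ₑ * ‖v p.2‖ₑ) ∂μ.prod μ ≤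
      (∫⁻ h, k h ∂μ) * (eLpNorm u 2 μ * eLpNorm v 2 μ) := by
  have huh (h : G) : StronglyMeasurable fun y => u (h + y) :=
    hu.comp_measurable (measurable_const_add h)
  have hΦ : Measurable fun q : G × G => k q.1 * (‖u (q.1 + q.2)‖ₑ * ‖v q.2‖ₑ) :=
    (hk.comp measurable_fst).mul ((hu.enorm.comp (measurable_fst.add measurable_snd)).mul
      (hv.enorm.comp measurable_snd))
  calc ∫⁻ p, k (p.1 - p.2) * (‖u p.1‖ₑ * ‖v p.2‖ₑ) ∂μ.prod μ
      = ∫⁻ h, ∫⁻ y, k h * (‖u (h + y)‖ₑ * ‖v y‖ₑ) ∂μ ∂μ := by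
        simpa using lintegral_prod_sub (μ := μ) hΦ
    _ ≤ ∫⁻ h, k h * (eLpNorm u 2 μ * eLpNorm v 2 μ) ∂μ := by
        refine lintegral_mono fun h => ?_
        have : Measurable fun y => ‖u (h + y)‖ₑ * ‖v y‖ₑ := (huh h).enorm.mul hv.enorm
        rw [lintegral_const_mul _ this, ← eLpNorm_comp_add_left hu.aestronglyMeasurable h]
        gcongr
        exact lintegral_enorm_mul_enorm_le (huh h).aestronglyMeasurable hv.aestronglyMeasurable
    _ = _ := lintegral_mul_const _ hk

theorem lintegral_mul_enorm_sub_sq {k : G → ℝ≥0∞} (hk : Measurable k) {u : G → E}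
    (hu : StronglyMeasurable u) :
    ∫⁻ p, k (p.1 - p.2) * ‖u p.1 - u p.2‖ₑ ^ 2 ∂μ.prod μ =
      ∫⁻ h, k h * eLpNorm (fun y => u (h + y) - u y) 2 μ ^ 2 ∂μ := by
  have hd : Measurable fun q : G × G => ‖u (q.1 + q.2) - u q.2‖ₑ ^ 2 :=
    (((hu.comp_measurable (measurable_fst.add measurable_snd)).sub
      (hu.comp_measurable measurable_snd)).enorm).pow_const 2
  have hΦ : Measurable fun q : G × G => k q.1 * ‖u (q.1 + q.2) - u q.2‖ₑ ^ 2 :=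
    (hk.comp measurable_fst).mul hd
  have := lintegral_prod_sub (μ := μ) hΦ
  simp only [sub_add_cancel] at this
  rw [this]
  refine lintegral_congr fun h => ?_
  have : Measurable fun y => ‖u (h + y) - u y‖ₑ ^ 2 :=
    ((hu.comp_measurable (measurable_const_add h)).sub hu).enorm.pow_const 2
  rw [eLpNorm_two_sq, lintegral_const_mul _ this]

theorem lintegral_mul_enorm_sub_sq_le {k : G → ℝ≥0∞} (hk : Measurable k) {u : G → E}
    (hu : StronglyMeasurable u) :
    ∫⁻ p, k (p.1 - p.2) * ‖u p.1 - u p.2‖ₑ ^ 2 ∂μ.prod μ ≤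
      (∫⁻ h, k h ∂μ) * (2 * eLpNorm u 2 μ) ^ 2 := by
  rw [lintegral_mul_enorm_sub_sq hk hu, ← lintegral_mul_const _ hk]
  refine lintegral_mono fun h => ?_
  gcongr
  calc eLpNorm (fun y => u (h + y) - u y) 2 μ
      ≤ eLpNorm (fun y => u (h + y)) 2 μ + eLpNorm u 2 μ :=
        eLpNorm_sub_le (hu.comp_measurable (measurable_const_add h)).aestronglyMeasurable
          hu.aestronglyMeasurable one_le_two
    _ = 2 * eLpNorm u 2 μ := by rw [eLpNorm_comp_add_left hu.aestronglyMeasurable, two_mul]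

end Translation

variable {n : ℕ} {s : ℝ}

theorem fracConst_pos (hs0 : 0 < s) (hs1 : s < 1) : 0 < fracConst n s := by
  have hΓ : Real.Gamma (-s) ≠ 0 := by
    refine Real.Gamma_ne_zero fun m hm => ?_
    rw [neg_inj] at hm
    have hm0 : 0 < m := by exact_mod_cast hm ▸ hs0
    have hm1 : m < 1 := by exact_mod_cast hm ▸ hs1
    lia
  have := Real.Gamma_pos_of_pos (s := n / 2 + s) (by positivity)
  have := abs_pos.mpr hΓ
  unfold fracConst
  positivity

/-- The vector kernel `√(C_{n,s} / 2) z / |z|^{n/2 + s + 1}` of the fractional gradient: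
`∇^s u (x, y) = (u x - u y) • gradKernel s (x - y)`. -/
noncomputable def gradKernel (s : ℝ) (z : Rn n) : Rn n :=
  (√(fracConst n s / 2) / ‖z‖ ^ ((n : ℝ) / 2 + s + 1)) • z

/-- The Gagliardo kernel `(C_{n,s} / 2) |z|^{-n-2s}`, the squared length of `gradKernel`. -/
noncomputable def fracKernel (s : ℝ) (z : Rn n) : ℝ≥0∞ := ‖gradKernel s z‖ₑ ^ 2

theorem fracGrad_eq (u : L2 n) (p : Rn n × Rn n) :
    fracGrad s u p = (u p.1 - u p.2) • gradKernel s (p.1 - p.2) := by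
  rw [fracGrad, gradKernel, smul_smul]
  congr 1
  ring

@[fun_prop]
theorem measurable_gradKernel : Measurable (gradKernel (n := n) s) := by
  unfold gradKernel; fun_prop

@[fun_prop]
theorem measurable_fracKernel : Measurable (fracKernel (n := n) s) := by
  unfold fracKernel; fun_prop

theorem norm_gradKernel (hs0 : 0 < s) (z : Rn n) :
    ‖gradKernel s z‖ = √(fracConst n s / 2) * ‖z‖ ^ (-((n : ℝ) / 2 + s)) := by
  rw [gradKernel, norm_smul, Real.norm_of_nonneg (by positivity), div_mul_eq_mul_div, mul_div_assoc]
  congr 1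
  obtain rfl | hz := eq_or_ne z 0
  · rw [norm_zero, zero_div, Real.zero_rpow (neg_ne_zero.mpr (by positivity))]
  · rw [Real.rpow_add (by positivity), Real.rpow_neg (by positivity), Real.rpow_one]
    field_simp

theorem fracKernel_eq_ofReal (hs0 : 0 < s) (hs1 : s < 1) (z : Rn n) :
    fracKernel s z = ENNReal.ofReal (fracConst n s / 2 * ‖z‖ ^ (-((n : ℝ) + 2 * s))) := by
  have := fracConst_pos (n := n) hs0 hs1
  rw [fracKernel, ← ofReal_norm, ← ENNReal.ofReal_pow (norm_nonneg _), norm_gradKernel hs0, mul_pow,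
    Real.sq_sqrt (by positivity), ← Real.rpow_mul_natCast (norm_nonneg _)]
  congr 3
  push_cast
  ring

theorem fracKernel_pos (hs0 : 0 < s) (hs1 : s < 1) {z : Rn n} (hz : z ≠ 0) :
    0 < fracKernel s z := by
  have := fracConst_pos (n := n) hs0 hs1
  rw [fracKernel_eq_ofReal hs0 hs1, ENNReal.ofReal_pos]
  positivity

theorem fracKernel_smul (hs0 : 0 < s) (hs1 : s < 1) {r : ℝ} (hr : 0 < r) (z : Rn n) :
    fracKernel s (r • z) = ENNReal.ofReal (r ^ (-((n : ℝ) + 2 * s))) * fracKernel s z := by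
  rw [fracKernel_eq_ofReal hs0 hs1, fracKernel_eq_ofReal hs0 hs1,
    ← ENNReal.ofReal_mul (by positivity), norm_smul, Real.norm_of_nonneg hr.le,
    Real.mul_rpow hr.le (norm_nonneg _)]
  congr 1
  ring

theorem fracKernel_isometry (e : Rn n ≃ₗᵢ[ℝ] Rn n) (z : Rn n) :
    fracKernel s (e z) = fracKernel s z := by
  simp only [fracKernel, gradKernel, e.norm_map, ← map_smul,
    enorm_eq_iff_norm_eq.mpr (e.norm_map _)]

/-- The part of the Gagliardo kernel at distance at least `δ` from the origin, which is
integrable. -/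
noncomputable def tailKernel (s δ : ℝ) : Rn n → ℝ≥0∞ := {z | δ ≤ ‖z‖}.indicator (fracKernel s)

@[fun_prop]
theorem measurable_tailKernel {δ : ℝ} : Measurable (tailKernel (n := n) s δ) :=
  measurable_fracKernel.indicator (measurableSet_le measurable_const measurable_norm)

theorem tailKernel_of_le {δ : ℝ} {z : Rn n} (h : δ ≤ ‖z‖) : tailKernel s δ z = fracKernel s z :=
  Set.indicator_of_mem (s := {z : Rn n | δ ≤ ‖z‖}) h _

theorem fracKernel_le_one_add_norm (hs0 : 0 < s) (hs1 : s < 1) {δ : ℝ} (hδ : 0 < δ) {z : Rn n}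
    (hz : δ ≤ ‖z‖) :
    fracKernel s z ≤ ENNReal.ofReal (fracConst n s / 2 * (δ⁻¹ + 1) ^ ((n : ℝ) + 2 * s)) *
      ENNReal.ofReal ((1 + ‖z‖) ^ (-((n : ℝ) + 2 * s))) := by
  have := fracConst_pos (n := n) hs0 hs1
  have hz0 : 0 < ‖z‖ := hδ.trans_le hz
  have hle : ‖z‖⁻¹ ≤ (δ⁻¹ + 1) * (1 + ‖z‖)⁻¹ := by
    rw [← div_eq_mul_inv, le_div_iff₀ (by positivity), mul_add, mul_one, inv_mul_cancel₀ hz0.ne']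
    gcongr
  rw [fracKernel_eq_ofReal hs0 hs1, ← ENNReal.ofReal_mul (by positivity), mul_assoc]
  refine ENNReal.ofReal_le_ofReal (mul_le_mul_of_nonneg_left ?_ (by positivity))
  rw [Real.rpow_neg_eq_inv_rpow, Real.rpow_neg_eq_inv_rpow,
    ← Real.mul_rpow (by positivity) (by positivity)]
  exact Real.rpow_le_rpow (by positivity) hle (by positivity)

theorem lintegral_tailKernel_lt_top (hs0 : 0 < s) (hs1 : s < 1) {δ : ℝ} (hδ : 0 < δ) :
    ∫⁻ z : Rn n, tailKernel s δ z < ⊤ := by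
  have hJ := finite_integral_one_add_norm (E := Rn n) (μ := volume) (r := n + 2 * s)
    (by simpa using hs0)
  calc ∫⁻ z : Rn n, tailKernel s δ z
      ≤ ∫⁻ z : Rn n, ENNReal.ofReal (fracConst n s / 2 * (δ⁻¹ + 1) ^ ((n : ℝ) + 2 * s)) *
        ENNReal.ofReal ((1 + ‖z‖) ^ (-((n : ℝ) + 2 * s))) := by
        refine lintegral_mono fun z => ?_
        exact Set.indicator_le (fun z hz => fracKernel_le_one_add_norm hs0 hs1 hδ hz) z
    _ < ⊤ := by
        rw [lintegral_const_mul _ (by fun_prop)]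
        exact ENNReal.mul_lt_top ENNReal.ofReal_lt_top hJ

theorem lintegral_fracKernel_mul_sq_ball_lt_top (hs0 : 0 < s) (hs1 : s < 1) :
    ∫⁻ z in Metric.ball (0 : Rn n) 1, fracKernel s z * ‖z‖ₑ ^ 2 < ⊤ := by
  obtain rfl | hn := n.eq_zero_or_pos
  · simp [Subsingleton.elim _ (0 : Rn 0)]
  have := fracConst_pos (n := n) hs0 hs1
  have hint := integrableOn_ball_of_norm_le_rpow (E := Rn n) (μ := volume) (F := ℝ)
    (f := fun z => fracConst n s / 2 * ‖z‖ ^ (-((n : ℝ) + 2 * s)) * ‖z‖ ^ 2)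
    (C := fracConst n s / 2) (α := n + 2 * s - 2) (r := 1)
    (by simpa using Nat.succ_le_iff.mpr hn) (by simp; linarith) ?_ (by fun_prop)
  · refine lt_of_eq_of_lt (lintegral_congr fun z => ?_) hint.2
    rw [fracKernel_eq_ofReal hs0 hs1, enorm_mul, Real.enorm_of_nonneg (by positivity), enorm_pow,
      enorm_norm]
  · refine Eventually.of_forall fun z => ?_
    rw [Real.norm_of_nonneg (by positivity), mul_assoc]
    gcongr
    obtain rfl | hz := eq_or_ne z 0
    · rw [norm_zero, zero_pow two_ne_zero, mul_zero]
      positivity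
    · rw [← Real.rpow_natCast, ← Real.rpow_add (norm_pos_iff.mpr hz)]
      refine le_of_eq (congrArg _ ?_)
      push_cast
      ring

/-- Complex-valued `L²(ℝⁿ)`, the target of `fourierL2`. -/
abbrev L2C (n : ℕ) : Type := Lp ℂ 2 (volume : Measure (Rn n))

/-- The Fourier character `exp(2πi h·ξ)`. -/
noncomputable def fourierPhase (h ξ : Rn n) : ℂ := (Real.fourierChar ⟪h, ξ⟫ : ℂ)

theorem norm_fourierPhase (h ξ : Rn n) : ‖fourierPhase h ξ‖ = 1 := Circle.norm_coe _

@[fun_prop]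
theorem continuous_fourierPhase {α : Type*} [TopologicalSpace α] {f g : α → Rn n}
    (hf : Continuous f) (hg : Continuous g) : Continuous fun x => fourierPhase (f x) (g x) :=
  continuous_subtype_val.comp (Real.continuous_fourierChar.comp (hf.inner hg))

@[fun_prop]
theorem measurable_fourierPhase {α : Type*} [MeasurableSpace α] {f g : α → Rn n}
    (hf : Measurable f) (hg : Measurable g) : Measurable fun x => fourierPhase (f x) (g x) :=
  (continuous_subtype_val.comp Real.continuous_fourierChar).measurable.comp (hf.inner hg)

theorem norm_fourierPhase_sub_one (h ξ : Rn n) :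
    ‖fourierPhase h ξ - 1‖ = 2 * |Real.sin (Real.pi * ⟪h, ξ⟫)| := by
  rw [fourierPhase, Real.fourierChar_apply, mul_comm, Complex.norm_exp_I_mul_ofReal_sub_one,
    Real.norm_eq_abs, abs_mul, abs_two]
  congr 3
  ring

/-- Translation by `h` as an isometry of `L²`. -/
noncomputable def translate (h : Rn n) : L2C n →ₗᵢ[ℂ] L2C n :=
  Lp.compMeasurePreservingₗᵢ ℂ (h + ·) (measurePreserving_add_left volume h)

theorem coeFn_translate (h : Rn n) (u : L2C n) : translate h u =ᵐ[volume] fun x => u (h + x) :=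
  Lp.coeFn_compMeasurePreserving u (measurePreserving_add_left volume h)

/-- Multiplication by `fourierPhase h` as an operator on `L²`. -/
noncomputable def modulate (h : Rn n) : L2C n →L[ℂ] L2C n :=
  (ContinuousLinearMap.mul ℂ ℂ).holderL volume ⊤ 2 2
    (MemLp.toLp (fourierPhase h) (memLp_top_of_bound
      (continuous_fourierPhase continuous_const continuous_id).aestronglyMeasurable 1
      (.of_forall fun ξ => (norm_fourierPhase h ξ).le)))

theorem coeFn_modulate (h : Rn n) (u : L2C n) :
    modulate h u =ᵐ[volume] fun ξ => fourierPhase h ξ * u ξ := by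
  refine (ContinuousLinearMap.coeFn_holder _ _ _).trans ?_
  filter_upwards [MemLp.coeFn_toLp (p := ⊤) (f := fourierPhase h) _] with ξ hξ
  rw [hξ, ContinuousLinearMap.mul_apply']

theorem translate_toLp (h : Rn n) (f : 𝓢(Rn n, ℂ)) :
    translate h (f.toLp 2 volume) = (f.compSubConstCLM ℂ (-h)).toLp 2 volume := by
  refine Lp.ext ?_
  have hf := (measurePreserving_add_left (volume : Measure (Rn n)) h
    ).quasiMeasurePreserving.ae_eq_comp (f.coeFn_toLp 2 volume)
  filter_upwards [coeFn_translate h (f.toLp 2 volume), hf,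
    (f.compSubConstCLM ℂ (-h)).coeFn_toLp 2 volume] with x hx hx' hx''
  rw [Function.comp_apply, Function.comp_apply] at hx'
  rw [hx, hx', hx'', SchwartzMap.compSubConstCLM_apply, sub_neg_eq_add, add_comm]

theorem fourier_compSubConstCLM (h ξ : Rn n) (f : 𝓢(Rn n, ℂ)) :
    𝓕 (f.compSubConstCLM ℂ (-h)) ξ = fourierPhase h ξ * 𝓕 f ξ := by
  have hcomp : (f.compSubConstCLM ℂ (-h) : Rn n → ℂ) = f ∘ fun x => x + h := by
    ext x
    simp
  rw [SchwartzMap.fourier_coe, SchwartzMap.fourier_coe, hcomp]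
  exact congrFun (VectorFourier.fourierIntegral_comp_add_right Real.fourierChar volume
    (innerₗ (Rn n)) f h) ξ

theorem fourier_translate (h : Rn n) (u : L2C n) : 𝓕 (translate h u) = modulate h (𝓕 u) := by
  have hdense := SchwartzMap.denseRange_toLpCLM (E := Rn n) (F := ℂ) (p := 2) (μ := volume)
    (by simp)
  have hleft : Continuous fun u : L2C n => 𝓕 (translate h u) :=
    (Lp.fourierTransformₗᵢ (Rn n) ℂ).continuous.comp (translate h).continuous
  have hright : Continuous fun u : L2C n => modulate h (𝓕 u) :=
    (modulate h).continuous.comp (Lp.fourierTransformₗᵢ (Rn n) ℂ).continuous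
  refine congrFun (hdense.equalizer hleft hright (funext fun f => ?_)) u
  rw [Function.comp_apply, Function.comp_apply, SchwartzMap.toLpCLM_apply, translate_toLp,
    SchwartzMap.toLp_fourier_eq, SchwartzMap.toLp_fourier_eq]
  refine Lp.ext ?_
  filter_upwards [(𝓕 (f.compSubConstCLM ℂ (-h))).coeFn_toLp 2 volume,
    coeFn_modulate h ((𝓕 f).toLp 2 volume), (𝓕 f).coeFn_toLp 2 volume] with ξ hξ hξ' hξ''
  rw [hξ, hξ', hξ'', fourier_compSubConstCLM]

theorem eLpNorm_fourier (u : L2C n) : eLpNorm (𝓕 u : L2C n) 2 volume = eLpNorm u 2 volume := by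
  rw [← Lp.enorm_def, ← Lp.enorm_def, enorm_eq_iff_norm_eq, Lp.norm_fourier_eq]

theorem coeFn_ofReal_compLp (u : L2 n) :
    (Complex.ofRealCLM.compLp u : L2C n) =ᵐ[volume] fun x => (u x : ℂ) :=
  ContinuousLinearMap.coeFn_compLp Complex.ofRealCLM u

theorem eLpNorm_fourierL2 (u : L2 n) : eLpNorm (fourierL2 u) 2 volume = ‖u‖ₑ := by
  rw [fourierL2, eLpNorm_fourier, Lp.enorm_def]
  refine eLpNorm_congr_norm_ae ?_
  filter_upwards [coeFn_ofReal_compLp u] with x hx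
  rw [hx, Complex.norm_real]

theorem eLpNorm_difference (u : L2 n) (h : Rn n) :
    eLpNorm (fun y => u (h + y) - u y) 2 volume =
      eLpNorm (fun ξ => (fourierPhase h ξ - 1) * fourierL2 u ξ) 2 volume := by
  set v : L2C n := Complex.ofRealCLM.compLp u with hv
  have hfourier : 𝓕 (translate h v - v) = modulate h (𝓕 v) - 𝓕 v := by
    rw [← fourier_translate]
    exact (Lp.fourierTransformₗᵢ (Rn n) ℂ).map_sub _ _
  calc eLpNorm (fun y => u (h + y) - u y) 2 volume
      = eLpNorm (translate h v - v : L2C n) 2 volume := by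
        have hshift := (measurePreserving_add_left (volume : Measure (Rn n)) h
          ).quasiMeasurePreserving.ae_eq_comp (coeFn_ofReal_compLp u)
        refine eLpNorm_congr_norm_ae ?_
        filter_upwards [Lp.coeFn_sub (translate h v) v, coeFn_translate h v,
          coeFn_ofReal_compLp u, hshift] with x hsub htr hx hx'
        rw [Function.comp_apply, Function.comp_apply] at hx'
        rw [hsub, Pi.sub_apply, htr, hv, hx, hx', ← Complex.ofReal_sub, Complex.norm_real]
    _ = eLpNorm (modulate h (𝓕 v) - 𝓕 v : L2C n) 2 volume := by
        rw [← hfourier, eLpNorm_fourier]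
    _ = eLpNorm (fun ξ => (fourierPhase h ξ - 1) * fourierL2 u ξ) 2 volume := by
        refine eLpNorm_congr_ae ?_
        filter_upwards [Lp.coeFn_sub (modulate h (𝓕 v)) (𝓕 v), coeFn_modulate h (𝓕 v)]
          with ξ hsub hmod
        rw [hsub, Pi.sub_apply, hmod, sub_one_mul, fourierL2]

/-- The Fourier symbol of `u ↦ ‖∇^s u‖²`, a multiple of `|2πξ|^{2s}` (`exists_fracSymbol_eq`). -/
noncomputable def fracSymbol (s : ℝ) (ξ : Rn n) : ℝ≥0∞ :=
  ∫⁻ h : Rn n, fracKernel s h * ‖fourierPhase h ξ - 1‖ₑ ^ 2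

theorem enorm_fracGrad (u : L2 n) (p : Rn n × Rn n) :
    ‖fracGrad s u p‖ₑ = ‖u p.1 - u p.2‖ₑ * ‖gradKernel s (p.1 - p.2)‖ₑ := by
  rw [fracGrad_eq, enorm_smul]

theorem enorm_fracGrad_sq (u : L2 n) (p : Rn n × Rn n) :
    ‖fracGrad s u p‖ₑ ^ 2 = fracKernel s (p.1 - p.2) * ‖u p.1 - u p.2‖ₑ ^ 2 := by
  rw [enorm_fracGrad, mul_pow, mul_comm, fracKernel]

theorem eLpNorm_fracGrad_sq (u : L2 n) :
    eLpNorm (fracGrad s u) 2 volume ^ 2 =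
      ∫⁻ h, fracKernel s h * eLpNorm (fun y => u (h + y) - u y) 2 volume ^ 2 := by
  simp_rw [eLpNorm_two_sq (fracGrad s u), enorm_fracGrad_sq]
  exact lintegral_mul_enorm_sub_sq measurable_fracKernel (Lp.stronglyMeasurable u)

theorem eLpNorm_fracGrad_sq_eq_lintegral_fracSymbol (u : L2 n) :
    eLpNorm (fracGrad s u) 2 volume ^ 2 = ∫⁻ ξ, fracSymbol s ξ * ‖fourierL2 u ξ‖ₑ ^ 2 := by
  calc eLpNorm (fracGrad s u) 2 volume ^ 2
      = ∫⁻ h, ∫⁻ ξ, fracKernel s h * ‖fourierPhase h ξ - 1‖ₑ ^ 2 * ‖fourierL2 u ξ‖ₑ ^ 2 := by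
        rw [eLpNorm_fracGrad_sq]
        refine lintegral_congr fun h => ?_
        rw [eLpNorm_difference, eLpNorm_two_sq, ← lintegral_const_mul _ (by fun_prop)]
        simp_rw [enorm_mul, mul_pow, mul_assoc]
    _ = ∫⁻ ξ, ∫⁻ h, fracKernel s h * ‖fourierPhase h ξ - 1‖ₑ ^ 2 * ‖fourierL2 u ξ‖ₑ ^ 2 :=
        lintegral_lintegral_swap (Measurable.aemeasurable (by
          simp only [Function.uncurry_def]
          fun_prop))
    _ = ∫⁻ ξ, fracSymbol s ξ * ‖fourierL2 u ξ‖ₑ ^ 2 := by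
        refine lintegral_congr fun ξ => ?_
        rw [lintegral_mul_const _ (by fun_prop), fracSymbol]

theorem fracSymbol_isometry (e : Rn n ≃ₗᵢ[ℝ] Rn n) (ξ : Rn n) :
    fracSymbol s (e ξ) = fracSymbol s ξ := by
  rw [fracSymbol, ← e.measurePreserving.lintegral_comp (by fun_prop)]
  simp_rw [fracKernel_isometry, fourierPhase, e.inner_map_map]
  rfl

theorem fracSymbol_eq_of_norm_eq {ξ η : Rn n} (h : ‖ξ‖ = ‖η‖) :
    fracSymbol s ξ = fracSymbol s η := by
  rw [← Submodule.reflection_sub h.symm, fracSymbol_isometry]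

theorem lintegral_comp_smul {f : Rn n → ℝ≥0∞} (hf : Measurable f) {r : ℝ} (hr : 0 < r) :
    ∫⁻ x, f x = ENNReal.ofReal (r ^ n) * ∫⁻ x, f (r • x) := by
  have hmap := Measure.map_addHaar_smul (volume : Measure (Rn n)) hr.ne'
  rw [← lintegral_map (g := (r • ·)) hf (by fun_prop), hmap, lintegral_smul_measure, smul_eq_mul,
    ← mul_assoc, ← ENNReal.ofReal_mul (by positivity), finrank_euclideanSpace_fin,
    abs_of_pos (by positivity), mul_inv_cancel₀ (by positivity), ENNReal.ofReal_one, one_mul]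

theorem lintegral_fracKernel_mul (hs0 : 0 < s) (hs1 : s < 1) {f : Rn n → ℝ≥0∞} (hf : Measurable f)
    {r : ℝ} (hr : 0 < r) : ENNReal.ofReal (r ^ (2 * s)) * ∫⁻ h, fracKernel s h * f h =
      ∫⁻ h, fracKernel s h * f (r • h) := by
  have hpow : r ^ (2 * s) * (r ^ n * r ^ (-((n : ℝ) + 2 * s))) = 1 := by
    rw [← Real.rpow_natCast, ← Real.rpow_add hr, ← Real.rpow_add hr, ← Real.rpow_zero r]
    congr 1
    ring
  rw [lintegral_comp_smul (f := fun h => _ * f h) (by fun_prop) hr]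
  simp_rw [fracKernel_smul hs0 hs1 hr, mul_assoc]
  rw [lintegral_const_mul _ (by fun_prop), ← mul_assoc, ← mul_assoc,
    ← ENNReal.ofReal_mul (by positivity), ← ENNReal.ofReal_mul (by positivity), mul_assoc, hpow,
    ENNReal.ofReal_one, one_mul]

theorem fracSymbol_smul (hs0 : 0 < s) (hs1 : s < 1) {r : ℝ} (hr : 0 < r) (ξ : Rn n) :
    fracSymbol s (r • ξ) = ENNReal.ofReal (r ^ (2 * s)) * fracSymbol s ξ := by
  have hphase (h : Rn n) : fourierPhase (r • h) ξ = fourierPhase h (r • ξ) := by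
    simp only [fourierPhase, real_inner_smul_left, real_inner_smul_right]
  rw [fracSymbol, fracSymbol, lintegral_fracKernel_mul hs0 hs1 (by fun_prop) hr]
  simp_rw [hphase]

theorem enorm_fourierPhase_sub_one_le (h ξ : Rn n) :
    ‖fourierPhase h ξ - 1‖ₑ ≤ ENNReal.ofReal (2 * Real.pi * ‖ξ‖) * ‖h‖ₑ := by
  rw [← ofReal_norm, ← ofReal_norm, ← ENNReal.ofReal_mul (by positivity)]
  refine ENNReal.ofReal_le_ofReal ?_
  calc ‖fourierPhase h ξ - 1‖ ≤ 2 * |Real.pi * ⟪h, ξ⟫| := by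
        rw [norm_fourierPhase_sub_one]
        exact mul_le_mul_of_nonneg_left Real.abs_sin_le_abs zero_le_two
    _ ≤ 2 * (Real.pi * (‖h‖ * ‖ξ‖)) := by
        rw [abs_mul, abs_of_pos Real.pi_pos]
        gcongr
        exact abs_real_inner_le_norm h ξ
    _ = 2 * Real.pi * ‖ξ‖ * ‖h‖ := by ring

theorem enorm_fourierPhase_sub_one_le_two (h ξ : Rn n) : ‖fourierPhase h ξ - 1‖ₑ ≤ 2 := by
  rw [← ofReal_norm, ENNReal.ofReal_le_ofNat, norm_fourierPhase_sub_one]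
  linarith [Real.abs_sin_le_one (Real.pi * ⟪h, ξ⟫)]

theorem fracSymbol_lt_top (hs0 : 0 < s) (hs1 : s < 1) (ξ : Rn n) : fracSymbol s ξ < ⊤ := by
  rw [fracSymbol, ← lintegral_add_compl _ (Metric.isOpen_ball (x := 0) (ε := 1)).measurableSet]
  refine ENNReal.add_lt_top.mpr ⟨?_, ?_⟩
  · calc ∫⁻ h in Metric.ball 0 1, fracKernel s h * ‖fourierPhase h ξ - 1‖ₑ ^ 2
        ≤ ∫⁻ h in Metric.ball 0 1,
            ENNReal.ofReal (2 * Real.pi * ‖ξ‖) ^ 2 * (fracKernel s h * ‖h‖ₑ ^ 2) := by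
          refine lintegral_mono fun h => ?_
          rw [mul_left_comm, ← mul_pow]
          gcongr
          exact enorm_fourierPhase_sub_one_le h ξ
      _ < ⊤ := by
          rw [lintegral_const_mul _ (by fun_prop)]
          exact ENNReal.mul_lt_top (ENNReal.pow_lt_top ENNReal.ofReal_lt_top)
            (lintegral_fracKernel_mul_sq_ball_lt_top hs0 hs1)
  · calc ∫⁻ h in (Metric.ball 0 1)ᶜ, fracKernel s h * ‖fourierPhase h ξ - 1‖ₑ ^ 2
        ≤ ∫⁻ h in (Metric.ball 0 1)ᶜ, tailKernel s 1 h * 2 ^ 2 := by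
          refine setLIntegral_mono (by fun_prop) fun h hh => ?_
          rw [tailKernel_of_le (by simpa using hh)]
          gcongr
          exact enorm_fourierPhase_sub_one_le_two h ξ
      _ ≤ ∫⁻ h : Rn n, tailKernel s 1 h * 2 ^ 2 := setLIntegral_le_lintegral _ _
      _ < ⊤ := by
          rw [lintegral_mul_const _ (by fun_prop)]
          exact ENNReal.mul_lt_top (lintegral_tailKernel_lt_top hs0 hs1 one_pos) (by simp)

theorem fracSymbol_pos (hs0 : 0 < s) (hs1 : s < 1) {ξ : Rn n} (hξ : ξ ≠ 0) :
    0 < fracSymbol s ξ := by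
  have : Nontrivial (Rn n) := nontrivial_of_ne ξ 0 hξ
  refine pos_iff_ne_zero.mpr fun h0 => ?_
  rw [fracSymbol, lintegral_eq_zero_iff (by fun_prop)] at h0
  have hphase : (fun h => fourierPhase h ξ) =ᵐ[volume] fun _ => 1 := by
    filter_upwards [h0, Measure.ae_ne volume 0] with h hh hne
    simpa [(fracKernel_pos hs0 hs1 hne).ne', sub_eq_zero] using hh
  have hone := congrFun (Continuous.ae_eq_iff_eq volume (by fun_prop) continuous_const |>.mp hphase)
    ((2 * ‖ξ‖ ^ 2)⁻¹ • ξ)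
  have hsin := norm_fourierPhase_sub_one ((2 * ‖ξ‖ ^ 2)⁻¹ • ξ) ξ
  have hpi : Real.pi * ⟪(2 * ‖ξ‖ ^ 2)⁻¹ • ξ, ξ⟫ = Real.pi / 2 := by
    have := norm_pos_iff.mpr hξ
    rw [real_inner_smul_left, real_inner_self_eq_norm_sq]
    field_simp
  rw [hone, hpi, Real.sin_pi_div_two] at hsin
  simp at hsin

theorem exists_fracSymbol_eq (hs0 : 0 < s) (hs1 : s < 1) : ∃ c : ℝ≥0, c ≠ 0 ∧
    ∀ ξ : Rn n, fracSymbol s ξ = c * ENNReal.ofReal ((2 * Real.pi * ‖ξ‖) ^ (2 * s)) := by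
  have hzero : fracSymbol s (0 : Rn n) = 0 := by simp [fracSymbol, fourierPhase]
  have hpow0 : (2 * Real.pi * ‖(0 : Rn n)‖) ^ (2 * s) = 0 := by
    rw [norm_zero, mul_zero, Real.zero_rpow (by positivity)]
  obtain h | h := subsingleton_or_nontrivial (Rn n)
  · refine ⟨1, one_ne_zero, fun ξ => ?_⟩
    rw [Subsingleton.elim ξ 0, hzero, hpow0, ENNReal.ofReal_zero, mul_zero]
  obtain ⟨e, he⟩ := exists_norm_eq (Rn n) (c := (2 * Real.pi)⁻¹) (by positivity)
  lift fracSymbol s e to ℝ≥0 using (fracSymbol_lt_top hs0 hs1 e).ne with c hc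
  refine ⟨c, ?_, fun ξ => ?_⟩
  · rw [← ENNReal.coe_ne_zero, hc]
    refine (fracSymbol_pos hs0 hs1 ?_).ne'
    rw [← norm_ne_zero_iff, he]
    positivity
  obtain rfl | hξ := eq_or_ne ξ 0
  · rw [hzero, hpow0, ENNReal.ofReal_zero, mul_zero]
  have hr : 0 < 2 * Real.pi * ‖ξ‖ := by positivity
  rw [hc, mul_comm, ← fracSymbol_smul hs0 hs1 hr]
  refine fracSymbol_eq_of_norm_eq ?_
  rw [norm_smul, he, Real.norm_of_nonneg hr.le]
  field_simp

theorem hsNorm_sq (u : L2 n) : hsNorm s u ^ 2 =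
    ∫⁻ ξ, ENNReal.ofReal ((1 + (2 * Real.pi * ‖ξ‖) ^ 2) ^ s) * ‖fourierL2 u ξ‖ₑ ^ 2 := by
  rw [hsNorm, eLpNorm_two_sq]
  refine lintegral_congr fun ξ => ?_
  rw [enorm_smul, mul_pow, Real.enorm_of_nonneg (by positivity),
    ← ENNReal.ofReal_pow (by positivity), ← Real.rpow_mul_natCast (by positivity)]
  norm_num

theorem enorm_le_hsNorm (hs0 : 0 ≤ s) (u : L2 n) : ‖u‖ₑ ≤ hsNorm s u := by
  rw [← ENNReal.pow_le_pow_left_iff two_ne_zero, ← eLpNorm_fourierL2, eLpNorm_two_sq, hsNorm_sq]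
  refine lintegral_mono fun ξ => le_mul_of_one_le_left' (ENNReal.one_le_ofReal.mpr ?_)
  exact Real.one_le_rpow (le_add_of_nonneg_right (by positivity)) hs0

theorem exists_fracGrad_sq_equiv (hs0 : 0 < s) (hs1 : s < 1) : ∃ c : ℝ≥0, c ≠ 0 ∧ ∀ u : L2 n,
    eLpNorm (fracGrad s u) 2 volume ^ 2 ≤ c * hsNorm s u ^ 2 ∧
    c * hsNorm s u ^ 2 ≤ c * ‖u‖ₑ ^ 2 + eLpNorm (fracGrad s u) 2 volume ^ 2 := by
  obtain ⟨c, hc, hsymbol⟩ := exists_fracSymbol_eq (n := n) hs0 hs1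
  have hpow (ξ : Rn n) : (2 * Real.pi * ‖ξ‖) ^ (2 * s) = ((2 * Real.pi * ‖ξ‖) ^ 2) ^ s := by
    rw [← Real.rpow_natCast_mul (by positivity), Nat.cast_ofNat]
  refine ⟨c, hc, fun u => ⟨?_, ?_⟩⟩
  · rw [eLpNorm_fracGrad_sq_eq_lintegral_fracSymbol, hsNorm_sq,
      ← lintegral_const_mul _ (by fun_prop)]
    refine lintegral_mono fun ξ => ?_
    rw [hsymbol, hpow, mul_assoc]
    gcongr
    exact le_add_of_nonneg_left zero_le_one
  · rw [eLpNorm_fracGrad_sq_eq_lintegral_fracSymbol, hsNorm_sq, ← eLpNorm_fourierL2, eLpNorm_two_sq,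
      ← lintegral_const_mul _ (by fun_prop), ← lintegral_const_mul _ (by fun_prop),
      ← lintegral_add_left (by fun_prop)]
    refine lintegral_mono fun ξ => ?_
    rw [hsymbol, hpow, mul_assoc (c : ℝ≥0∞), ← mul_add, ← one_add_mul, ← ENNReal.ofReal_one,
      ← ENNReal.ofReal_add zero_le_one (by positivity)]
    gcongr
    simpa using Real.rpow_add_le_add_rpow zero_le_one (sq_nonneg (2 * Real.pi * ‖ξ‖)) hs0.le hs1.le

theorem exists_fracGrad_equiv (hs0 : 0 < s) (hs1 : s < 1) : ∃ c : ℝ≥0, c ≠ 0 ∧ ∀ u : L2 n,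
    eLpNorm (fracGrad s u) 2 volume ≤ c * hsNorm s u ∧
    c * hsNorm s u ≤ c * ‖u‖ₑ + eLpNorm (fracGrad s u) 2 volume := by
  obtain ⟨c, hc, h⟩ := exists_fracGrad_sq_equiv (n := n) hs0 hs1
  obtain ⟨d, rfl⟩ : ∃ d : ℝ≥0, d ^ 2 = c := ⟨NNReal.sqrt c, NNReal.sq_sqrt c⟩
  refine ⟨d, pow_ne_zero_iff two_ne_zero |>.mp hc, fun u => ?_⟩
  obtain ⟨hupper, hlower⟩ := h u
  rw [ENNReal.coe_pow, ← mul_pow] at hupper hlower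
  rw [← mul_pow] at hlower
  constructor
  · exact (ENNReal.pow_le_pow_left_iff two_ne_zero).mp hupper
  · refine (ENNReal.pow_le_pow_left_iff two_ne_zero).mp (hlower.trans ?_)
    exact pow_add_pow_le zero_le zero_le two_ne_zero

theorem memHs_iff (hs0 : 0 < s) (hs1 : s < 1) {u : L2 n} :
    MemHs s u ↔ eLpNorm (fracGrad s u) 2 volume < ⊤ := by
  obtain ⟨c, hc, h⟩ := exists_fracGrad_equiv (n := n) hs0 hs1
  refine ⟨fun hu => (h u).1.trans_lt (ENNReal.mul_lt_top ENNReal.coe_lt_top hu), fun hu => ?_⟩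
  have := (h u).2.trans_lt
    (ENNReal.add_lt_top.mpr ⟨ENNReal.mul_lt_top ENNReal.coe_lt_top enorm_lt_top, hu⟩)
  exact ENNReal.lt_top_of_mul_ne_top_right this.ne (ENNReal.coe_ne_zero.mpr hc)

theorem coeFn_testL2 {U : Opens (Rn n)} (φ : 𝓓(U, ℝ)) : testL2 φ =ᵐ[volume] φ :=
  MemLp.coeFn_toLp _

theorem enorm_testL2 {U : Opens (Rn n)} (φ : 𝓓(U, ℝ)) : ‖testL2 φ‖ₑ = eLpNorm φ 2 volume :=
  Lp.enorm_toLp _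

/-- `testL2` as a linear map. -/
noncomputable def testL2ₗ (U : Opens (Rn n)) : 𝓓(U, ℝ) →ₗ[ℝ] L2 n where
  toFun := testL2
  map_add' _ _ := MemLp.toLp_add _ _
  map_smul' c _ := MemLp.toLp_const_smul c _

theorem testL2_ae_eq_zero {U : Opens (Rn n)} (φ : 𝓓(U, ℝ)) {S : Set (Rn n)}
    (hS : tsupport φ ⊆ S) : ∀ᵐ x, x ∉ S → testL2 φ x = 0 := by
  filter_upwards [coeFn_testL2 φ] with x hx hxS
  rw [hx, image_eq_zero_of_notMem_tsupport fun h => hxS (hS h)]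

theorem hasTemperateGrowth_one_add_norm_sq_rpow (c r : ℝ) :
    (fun ξ : Rn n => (1 + (c * ‖ξ‖) ^ 2) ^ r).HasTemperateGrowth := by
  have hcomp : (fun ξ : Rn n => (1 + (c * ‖ξ‖) ^ 2) ^ r) =
      (fun ξ : Rn n => (1 + ‖ξ‖ ^ 2) ^ r) ∘ (c • ContinuousLinearMap.id ℝ (Rn n)) := by
    funext ξ
    simp [norm_smul, mul_pow]
  rw [hcomp]
  exact (Function.hasTemperateGrowth_one_add_norm_sq_rpow (Rn n) r).comp
    (c • ContinuousLinearMap.id ℝ (Rn n)).hasTemperateGrowth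

theorem memHs_testL2 {U : Opens (Rn n)} (φ : 𝓓(U, ℝ)) : MemHs s (testL2 φ) := by
  have hsupp : HasCompactSupport fun x => (φ x : ℂ) :=
    φ.hasCompactSupport.comp_left (g := fun t : ℝ => (t : ℂ)) Complex.ofReal_zero
  let f : 𝓢(Rn n, ℂ) := hsupp.toSchwartzMap (Complex.ofRealCLM.contDiff.comp φ.contDiff)
  have hf : Complex.ofRealCLM.compLp (testL2 φ) = f.toLp 2 volume := by
    refine Lp.ext ?_
    filter_upwards [coeFn_ofReal_compLp (testL2 φ), coeFn_testL2 φ, f.coeFn_toLp 2 volume]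
      with x hx hφ hf
    rw [hx, hφ, hf]
    rfl
  let g := SchwartzMap.smulLeftCLM ℂ
    (fun ξ : Rn n => (1 + (2 * Real.pi * ‖ξ‖) ^ 2) ^ (s / 2)) (𝓕 f)
  rw [MemHs, hsNorm, fourierL2, hf, SchwartzMap.toLp_fourier_eq]
  refine lt_of_eq_of_lt (eLpNorm_congr_ae ?_) (g.memLp 2 volume).2
  filter_upwards [(𝓕 f).coeFn_toLp 2 volume] with ξ hξ
  rw [SchwartzMap.smulLeftCLM_apply_apply (hasTemperateGrowth_one_add_norm_sq_rpow _ _), hξ]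

theorem MemHsTilde.ae_eq_zero (hs0 : 0 ≤ s) {Ω : Opens (Rn n)} {u : L2 n}
    (hu : MemHsTilde Ω s u) : ∀ᵐ x, x ∉ Ω → u x = 0 := by
  suffices eLpNorm u 2 (volume.restrict (Ω : Set (Rn n))ᶜ) = 0 by
    rw [eLpNorm_eq_zero_iff (by fun_prop) two_ne_zero, Filter.EventuallyEq,
      ae_restrict_iff' Ω.isOpen.measurableSet.compl] at this
    simpa using this
  refine le_antisymm (le_of_forall_gt fun ε hε => ?_) zero_le
  obtain ⟨φ, hφ⟩ := hu.2 ε hε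
  calc eLpNorm u 2 (volume.restrict (Ω : Set (Rn n))ᶜ)
      = eLpNorm (u - testL2 φ : L2 n) 2 (volume.restrict (Ω : Set (Rn n))ᶜ) := by
        refine eLpNorm_congr_ae ?_
        rw [Filter.EventuallyEq, ae_restrict_iff' Ω.isOpen.measurableSet.compl]
        filter_upwards [Lp.coeFn_sub u (testL2 φ), testL2_ae_eq_zero φ φ.tsupport_subset]
          with x hsub hzero hx
        rw [hsub, Pi.sub_apply, hzero hx, sub_zero]
    _ ≤ ‖u - testL2 φ‖ₑ := by
        rw [Lp.enorm_def]
        exact eLpNorm_restrict_le _ _ _ _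
    _ ≤ hsNorm s (u - testL2 φ) := enorm_le_hsNorm hs0 _
    _ < ε := hφ

theorem ae_prod_of_ae {P Q : Rn n → Prop} (hP : ∀ᵐ x, P x) (hQ : ∀ᵐ x, Q x) :
    ∀ᵐ p : Rn n × Rn n, P p.1 ∧ Q p.2 :=
  (Measure.quasiMeasurePreserving_fst.ae hP).and (Measure.quasiMeasurePreserving_snd.ae hQ)

theorem fracGrad_add (u v : L2 n) :
    fracGrad s (u + v) =ᵐ[volume] fracGrad s u + fracGrad s v := by
  filter_upwards [ae_prod_of_ae (Lp.coeFn_add u v) (Lp.coeFn_add u v)] with p hp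
  simp only [fracGrad_eq, hp.1, hp.2, Pi.add_apply]
  module

theorem fracGrad_smul (c : ℝ) (u : L2 n) : fracGrad s (c • u) =ᵐ[volume] c • fracGrad s u := by
  filter_upwards [ae_prod_of_ae (Lp.coeFn_smul c u) (Lp.coeFn_smul c u)] with p hp
  simp only [fracGrad_eq, hp.1, hp.2, Pi.smul_apply, smul_eq_mul]
  module

theorem sqrt_mul_sqrt_mem_Icc {a M x y : ℝ} (ha : 0 ≤ a) (hx : x ∈ Set.Icc a M)
    (hy : y ∈ Set.Icc a M) : √x * √y ∈ Set.Icc a M := by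
  have hM : 0 ≤ M := ha.trans (hx.1.trans hx.2)
  constructor
  · calc a = √a * √a := (Real.mul_self_sqrt ha).symm
      _ ≤ √x * √y := by gcongr <;> simp_all
  · calc √x * √y ≤ √M * √M := by gcongr <;> simp_all
      _ = M := Real.mul_self_sqrt hM

variable {γ : Rn n → ℝ}

theorem IsConductivity.exists_bounds (hγ : IsConductivity γ) :
    ∃ a M : ℝ≥0, a ≠ 0 ∧ ∀ᵐ x, γ x ∈ Set.Icc (a : ℝ) M := by
  obtain ⟨hL, a, ha, hlower⟩ := hγ
  have hupper : ∀ᵐ x, ‖γ x‖ₑ ≤ eLpNorm γ ⊤ volume := by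
    rw [eLpNorm_exponent_top]
    exact ae_le_eLpNormEssSup
  refine ⟨a.toNNReal, (eLpNorm γ ⊤ volume).toNNReal, (Real.toNNReal_pos.mpr ha).ne', ?_⟩
  filter_upwards [hlower, hupper] with x hx hx'
  rw [← ENNReal.coe_toNNReal hL.2.ne, enorm_le_coe] at hx'
  exact ⟨by rwa [Real.coe_toNNReal _ ha.le], (Real.le_norm_self _).trans hx'⟩

/-- The fractional gradient with the weight `(γ^{1/2}(x) γ^{1/2}(y))^{1/2}`, whose `L²` inner
products are the values of `condForm`. -/
noncomputable def condGrad (s : ℝ) (γ : Rn n → ℝ) (u : L2 n) (p : Rn n × Rn n) : Rn n :=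
  √(√(γ p.1) * √(γ p.2)) • fracGrad s u p

theorem condForm_eq_integral_inner_condGrad (u v : L2 n) :
    condForm s γ u v = ∫ p, ⟪condGrad s γ u p, condGrad s γ v p⟫ := by
  refine integral_congr_ae (Eventually.of_forall fun p => ?_)
  simp only [condGrad, real_inner_smul_left, real_inner_smul_right]
  rw [← mul_assoc, Real.mul_self_sqrt (by positivity)]

theorem condGrad_eq (u : L2 n) (p : Rn n × Rn n) : condGrad s γ u p =
    (u p.1 - u p.2) • √(√(γ p.1) * √(γ p.2)) • gradKernel s (p.1 - p.2) := by
  rw [condGrad, fracGrad_eq, smul_comm]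

theorem condGrad_add (u v : L2 n) :
    condGrad s γ (u + v) =ᵐ[volume] condGrad s γ u + condGrad s γ v := by
  filter_upwards [fracGrad_add (s := s) u v] with p hp
  simp only [condGrad, hp, Pi.add_apply, smul_add]

theorem condGrad_smul (c : ℝ) (u : L2 n) :
    condGrad s γ (c • u) =ᵐ[volume] c • condGrad s γ u := by
  filter_upwards [fracGrad_smul (s := s) c u] with p hp
  simp only [condGrad, hp, Pi.smul_apply, smul_comm c]

theorem condGrad_zero : condGrad s γ 0 =ᵐ[volume] 0 := by
  simpa only [zero_smul] using condGrad_smul (s := s) (γ := γ) 0 0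

theorem IsConductivity.aestronglyMeasurable_condGrad (hγ : IsConductivity γ) (u : L2 n) :
    AEStronglyMeasurable (condGrad s γ u) := by
  have hfst : AEMeasurable fun p : Rn n × Rn n => γ p.1 :=
    hγ.1.1.aemeasurable.comp_quasiMeasurePreserving Measure.quasiMeasurePreserving_fst
  have hsnd : AEMeasurable fun p : Rn n × Rn n => γ p.2 :=
    hγ.1.1.aemeasurable.comp_quasiMeasurePreserving Measure.quasiMeasurePreserving_snd
  have hgrad : AEMeasurable (fracGrad s u) := by
    rw [funext (fracGrad_eq u)]
    fun_prop
  exact ((hfst.sqrt.mul hsnd.sqrt).sqrt.smul hgrad).aestronglyMeasurable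

theorem IsConductivity.exists_enorm_condGrad_equiv (hγ : IsConductivity γ) :
    ∃ C : ℝ≥0, ∀ᵐ p, ∀ (s : ℝ) (u : L2 n), ‖condGrad s γ u p‖ₑ ≤ C * ‖fracGrad s u p‖ₑ ∧
      ‖fracGrad s u p‖ₑ ≤ C * ‖condGrad s γ u p‖ₑ := by
  obtain ⟨a, M, ha, hbounds⟩ := hγ.exists_bounds
  refine ⟨max (NNReal.sqrt M) (NNReal.sqrt a)⁻¹, ?_⟩
  filter_upwards [ae_prod_of_ae hbounds hbounds] with p hp s u
  obtain ⟨hlower, hupper⟩ := sqrt_mul_sqrt_mem_Icc a.2 hp.1 hp.2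
  have hmul (z : Rn n) : ‖√(√(γ p.1) * √(γ p.2)) • z‖ₑ =
      (NNReal.sqrt (√(γ p.1) * √(γ p.2)).toNNReal : ℝ≥0) * ‖z‖ₑ := by
    rw [enorm_smul, Real.enorm_of_nonneg (Real.sqrt_nonneg _), Real.sqrt, ENNReal.ofReal_coe_nnreal]
  rw [condGrad, hmul]
  constructor
  · gcongr
    refine le_max_of_le_left (NNReal.sqrt_le_sqrt.mpr ?_)
    exact Real.toNNReal_le_iff_le_coe.mpr hupper
  · rw [← mul_assoc]
    refine le_mul_of_one_le_left' ?_
    norm_cast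
    calc 1 = (NNReal.sqrt a)⁻¹ * NNReal.sqrt a := (inv_mul_cancel₀ (by simpa using ha)).symm
      _ ≤ _ := by
        gcongr
        · exact le_max_right _ _
        · exact NNReal.le_toNNReal_of_coe_le hlower

theorem IsConductivity.exists_eLpNorm_condGrad_equiv (hγ : IsConductivity γ) :
    ∃ C : ℝ≥0, ∀ (s : ℝ) (u : L2 n),
      eLpNorm (condGrad s γ u) 2 volume ≤ C * eLpNorm (fracGrad s u) 2 volume ∧
      eLpNorm (fracGrad s u) 2 volume ≤ C * eLpNorm (condGrad s γ u) 2 volume := by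
  obtain ⟨C, hC⟩ := hγ.exists_enorm_condGrad_equiv
  exact ⟨C, fun s u =>
    ⟨eLpNorm_le_nnreal_smul_eLpNorm_of_ae_le_mul' (hC.mono fun _ h => (h s u).1) 2,
      eLpNorm_le_nnreal_smul_eLpNorm_of_ae_le_mul' (hC.mono fun _ h => (h s u).2) 2⟩⟩

/-- `L²(ℝ²ⁿ; ℝⁿ)`, the space of the fractional gradients of functions in `H^s(ℝⁿ)`. -/
abbrev L2Grad (n : ℕ) : Type := Lp (Rn n) 2 (volume : Measure (Rn n × Rn n))

/-- The graph of the weighted fractional gradient `condGrad`, an unbounded operator from `L²(ℝⁿ)` to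
`L²(ℝ²ⁿ; ℝⁿ)`. Its domain is `H^s(ℝⁿ)`, and its graph norm is equivalent to the norm of `H^s`. -/
noncomputable def condGraph (s : ℝ) (γ : Rn n → ℝ) : Submodule ℝ (L2 n × L2Grad n) where
  carrier := {p | p.2 =ᵐ[volume] condGrad s γ p.1}
  add_mem' {p q} (hp : p.2 =ᵐ[volume] _) hq :=
    (Lp.coeFn_add p.2 q.2).trans <| (hp.add hq).trans (condGrad_add p.1 q.1).symm
  zero_mem' := (Lp.coeFn_zero _ _ _).trans condGrad_zero.symm
  smul_mem' c p (hp : p.2 =ᵐ[volume] _) :=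
    (Lp.coeFn_smul c p.2).trans <| (hp.const_smul c).trans (condGrad_smul c p.1).symm

theorem mem_condGraph {p : L2 n × L2Grad n} :
    p ∈ condGraph s γ ↔ p.2 =ᵐ[volume] condGrad s γ p.1 := Iff.rfl

theorem exists_subseq_ae_tendsto {α E : Type*} [MeasurableSpace α] [NormedAddCommGroup E]
    {μ : Measure α} {f : ℕ → Lp E 2 μ} {g : Lp E 2 μ} (h : Tendsto f atTop (𝓝 g)) :
    ∃ ns : ℕ → ℕ, StrictMono ns ∧ ∀ᵐ x ∂μ, Tendsto (fun i => f (ns i) x) atTop (𝓝 (g x)) :=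
  (tendstoInMeasure_of_tendsto_Lp h).exists_seq_tendsto_ae

theorem isClosed_condGraph : IsClosed (condGraph s γ : Set (L2 n × L2Grad n)) := by
  refine isClosed_of_closure_subset fun q hq => ?_
  obtain ⟨p, hp, hpq⟩ := mem_closure_iff_seq_limit.mp hq
  obtain ⟨ns, hns, hfst⟩ := exists_subseq_ae_tendsto ((continuous_fst.tendsto q).comp hpq)
  obtain ⟨ms, hms, hsnd⟩ :=
    exists_subseq_ae_tendsto (((continuous_snd.tendsto q).comp hpq).comp hns.tendsto_atTop)
  refine mem_condGraph.mpr ?_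
  filter_upwards [ae_prod_of_ae hfst hfst, hsnd, ae_all_iff.mpr fun i => mem_condGraph.mp (hp i)]
    with x hx hx' hgrad
  refine tendsto_nhds_unique hx' ?_
  simp only [Function.comp_apply, hgrad, condGrad_eq]
  exact ((hx.1.comp hms.tendsto_atTop).sub (hx.2.comp hms.tendsto_atTop)).smul_const _

theorem enorm_snd_of_mem_condGraph {p : L2 n × L2Grad n} (hp : p ∈ condGraph s γ) :
    ‖p.2‖ₑ = eLpNorm (condGrad s γ p.1) 2 volume := by
  rw [Lp.enorm_def, eLpNorm_congr_ae (mem_condGraph.mp hp)]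

theorem condForm_eq_inner {p q : L2 n × L2Grad n} (hp : p ∈ condGraph s γ)
    (hq : q ∈ condGraph s γ) : condForm s γ p.1 q.1 = ⟪p.2, q.2⟫ := by
  rw [condForm_eq_integral_inner_condGrad, L2.inner_def]
  refine integral_congr_ae ?_
  filter_upwards [mem_condGraph.mp hp, mem_condGraph.mp hq] with x hx hx'
  rw [hx, hx']

theorem MemHs.memLp_condGrad (hs0 : 0 < s) (hs1 : s < 1) (hγ : IsConductivity γ) {u : L2 n}
    (hu : MemHs s u) : MemLp (condGrad s γ u) 2 volume := by
  obtain ⟨C, hC⟩ := hγ.exists_eLpNorm_condGrad_equiv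
  exact ⟨hγ.aestronglyMeasurable_condGrad u,
    (hC s u).1.trans_lt (ENNReal.mul_lt_top ENNReal.coe_lt_top ((memHs_iff hs0 hs1).mp hu))⟩

theorem MemHs.exists_mem_condGraph (hs0 : 0 < s) (hs1 : s < 1) (hγ : IsConductivity γ)
    {u : L2 n} (hu : MemHs s u) : ∃ z, (u, z) ∈ condGraph s γ :=
  ⟨_, (hu.memLp_condGrad hs0 hs1 hγ).coeFn_toLp⟩

theorem enorm_prod_eq_max {E F : Type*} [SeminormedAddGroup E] [SeminormedAddGroup F] (p : E × F) :
    ‖p‖ₑ = max ‖p.1‖ₑ ‖p.2‖ₑ := by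
  simp only [enorm_eq_nnnorm, Prod.nnnorm_def, ENNReal.coe_max]

theorem exists_enorm_le_hsNorm (hs0 : 0 < s) (hs1 : s < 1) (hγ : IsConductivity γ) :
    ∃ C : ℝ≥0, ∀ p ∈ condGraph s γ, ‖p‖ₑ ≤ C * hsNorm s p.1 := by
  obtain ⟨c, -, hfrac⟩ := exists_fracGrad_equiv (n := n) hs0 hs1
  obtain ⟨C, hC⟩ := hγ.exists_eLpNorm_condGrad_equiv
  refine ⟨max 1 (C * c), fun p hp => ?_⟩
  rw [enorm_prod_eq_max, enorm_snd_of_mem_condGraph hp, ENNReal.coe_max, max_mul]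
  refine max_le_max ?_ ?_
  · rw [ENNReal.coe_one, one_mul]
    exact enorm_le_hsNorm hs0.le p.1
  · grw [(hC s p.1).1, (hfrac p.1).1, ENNReal.coe_mul, mul_assoc]

theorem exists_hsNorm_le_enorm (hs0 : 0 < s) (hs1 : s < 1) (hγ : IsConductivity γ) :
    ∃ C : ℝ≥0, ∀ p ∈ condGraph s γ, hsNorm s p.1 ≤ C * ‖p‖ₑ := by
  obtain ⟨c, hc, hfrac⟩ := exists_fracGrad_equiv (n := n) hs0 hs1
  obtain ⟨C, hC⟩ := hγ.exists_eLpNorm_condGrad_equiv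
  refine ⟨c⁻¹ * (c + C), fun p hp => ?_⟩
  calc hsNorm s p.1 = (c⁻¹ : ℝ≥0) * (c * hsNorm s p.1) := by
        rw [← mul_assoc, ← ENNReal.coe_mul, inv_mul_cancel₀ hc, ENNReal.coe_one, one_mul]
    _ ≤ (c⁻¹ : ℝ≥0) * (c * ‖p.1‖ₑ + C * ‖p.2‖ₑ) := by
        grw [(hfrac p.1).2, (hC s p.1).2, enorm_snd_of_mem_condGraph hp]
    _ ≤ (c⁻¹ : ℝ≥0) * (c * ‖p‖ₑ + C * ‖p‖ₑ) := by
        rw [enorm_prod_eq_max]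
        gcongr
        exacts [le_max_left _ _, le_max_right _ _]
    _ = (c⁻¹ * (c + C) : ℝ≥0) * ‖p‖ₑ := by
        rw [← add_mul, ← mul_assoc, ENNReal.coe_mul, ENNReal.coe_add]

theorem memHs_of_mem_condGraph (hs0 : 0 < s) (hs1 : s < 1) (hγ : IsConductivity γ)
    {u : L2 n} {z : L2Grad n} (hu : (u, z) ∈ condGraph s γ) : MemHs s u := by
  obtain ⟨C, hC⟩ := exists_hsNorm_le_enorm hs0 hs1 hγ
  exact (hC _ hu).trans_lt (ENNReal.mul_lt_top ENNReal.coe_lt_top enorm_lt_top)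

/-- The graph of `condGrad` on the domain `H̃^s(Ω)`, defined as the closure of the graph over
`C_c^∞(Ω)`. -/
noncomputable def tildeGraph (Ω : Opens (Rn n)) (s : ℝ) (γ : Rn n → ℝ) :
    Submodule ℝ (L2 n × L2Grad n) :=
  (condGraph s γ ⊓ (LinearMap.range (testL2ₗ Ω)).comap
    (LinearMap.fst ℝ (L2 n) (L2Grad n))).topologicalClosure

theorem isClosed_tildeGraph {Ω : Opens (Rn n)} :
    IsClosed (tildeGraph Ω s γ : Set (L2 n × L2Grad n)) :=
  Submodule.isClosed_topologicalClosure _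

theorem mem_tildeGraph_iff (hs0 : 0 < s) (hs1 : s < 1) (hγ : IsConductivity γ)
    {Ω : Opens (Rn n)} {p : L2 n × L2Grad n} :
    p ∈ tildeGraph Ω s γ ↔ p ∈ condGraph s γ ∧ MemHsTilde Ω s p.1 := by
  constructor
  · intro hp
    have hgraph : p ∈ condGraph s γ :=
      Submodule.topologicalClosure_minimal _ inf_le_left isClosed_condGraph hp
    refine ⟨hgraph, memHs_of_mem_condGraph hs0 hs1 hγ hgraph, fun ε hε => ?_⟩
    obtain ⟨C, hC⟩ := exists_hsNorm_le_enorm hs0 hs1 hγ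
    obtain ⟨q, ⟨hq, φ, hφ⟩, hpq⟩ := EMetric.mem_closure_iff.mp hp (ε / C)
      (ENNReal.div_pos hε.ne' ENNReal.coe_ne_top)
    rw [edist_eq_enorm_sub] at hpq
    refine ⟨φ, ?_⟩
    calc hsNorm s (p.1 - testL2 φ) = hsNorm s (p - q).1 := by rw [Prod.fst_sub]; congr 2
      _ ≤ C * ‖p - q‖ₑ := hC _ (sub_mem hgraph hq)
      _ < ε := ENNReal.mul_lt_of_lt_div' hpq
  · rintro ⟨hgraph, -, happrox⟩
    refine EMetric.mem_closure_iff.mpr fun ε hε => ?_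
    obtain ⟨C, hC⟩ := exists_enorm_le_hsNorm hs0 hs1 hγ
    obtain ⟨φ, hφ⟩ := happrox (ε / C) (ENNReal.div_pos hε.ne' ENNReal.coe_ne_top)
    obtain ⟨z, hz⟩ := (memHs_testL2 (s := s) φ).exists_mem_condGraph hs0 hs1 hγ
    refine ⟨(testL2 φ, z), ⟨hz, φ, rfl⟩, ?_⟩
    rw [edist_eq_enorm_sub]
    exact (hC _ (sub_mem hgraph hz)).trans_lt (ENNReal.mul_lt_of_lt_div' hφ)

theorem enorm_le_eLpNorm_difference {u : L2 n} {S : Set (Rn n)} (hu : ∀ᵐ x, x ∉ S → u x = 0)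
    {h : Rn n} (hS : ∀ x ∈ S, h + x ∉ S) :
    ‖u‖ₑ ≤ eLpNorm (fun y => u (h + y) - u y) 2 volume := by
  rw [Lp.enorm_def]
  refine eLpNorm_mono_enorm_ae ?_
  have hshift :=
    (measurePreserving_add_left (volume : Measure (Rn n)) h).quasiMeasurePreserving.ae hu
  filter_upwards [hu, hshift] with y hy hhy
  by_cases hyS : y ∈ S
  · simp [hhy (hS y hyS)]
  · simp [hy hyS]

/-- The slab of width `ε` orthogonal to `v`, one of whose faces is `{x | ⟪v, x⟫ = a}`. -/
def slab (v : Rn n) (a ε : ℝ) : Set (Rn n) := {x | ⟪v, x⟫ ∈ Set.Icc a (a + ε)}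

theorem lintegral_fracKernel_mul_enorm_sq_le (hs0 : 0 < s) (hs1 : s < 1) {v : Rn n} {a ε : ℝ}
    (hε : 0 < ε) {u : L2 n} (hu : ∀ᵐ x, x ∉ slab v a ε → u x = 0) :
    (∫⁻ z in {z | 1 < ⟪v, z⟫}, fracKernel s z) * ‖u‖ₑ ^ 2 ≤
      ENNReal.ofReal (ε ^ (2 * s)) * eLpNorm (fracGrad s u) 2 volume ^ 2 := by
  let H (r : ℝ) : Set (Rn n) := {z | r < ⟪v, z⟫}
  have hH (r : ℝ) : MeasurableSet (H r) := measurableSet_lt measurable_const (by fun_prop)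
  have hscale (z : Rn n) : (H 1).indicator (fun _ => ‖u‖ₑ ^ 2) z =
      (H ε).indicator (fun _ => ‖u‖ₑ ^ 2) (ε • z) := by
    have hmem : z ∈ H 1 ↔ ε • z ∈ H ε := by
      simp only [H, Set.mem_ofPred_eq, real_inner_smul_right, lt_mul_iff_one_lt_right hε]
    simp only [Set.indicator, hmem]
  have hdiff (h : Rn n) : (H ε).indicator (fun _ => ‖u‖ₑ ^ 2) h ≤
      eLpNorm (fun y => u (h + y) - u y) 2 volume ^ 2 := by
    refine Set.indicator_apply_le' (fun hh => ?_) fun _ => zero_le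
    have hh : ε < ⟪v, h⟫ := hh
    gcongr
    refine enorm_le_eLpNorm_difference hu fun x hx hhx => ?_
    rw [slab, Set.mem_ofPred_eq, inner_add_right] at hhx
    linarith [hx.1, hhx.2]
  calc (∫⁻ z in H 1, fracKernel s z) * ‖u‖ₑ ^ 2
      = ∫⁻ z, fracKernel s z * (H ε).indicator (fun _ => ‖u‖ₑ ^ 2) (ε • z) := by
        simp_rw [← hscale, ← Set.indicator_mul_right]
        rw [lintegral_indicator (hH 1), lintegral_mul_const _ measurable_fracKernel]
    _ = ENNReal.ofReal (ε ^ (2 * s)) *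
          ∫⁻ h, fracKernel s h * (H ε).indicator (fun _ => ‖u‖ₑ ^ 2) h :=
        (lintegral_fracKernel_mul hs0 hs1 (measurable_const.indicator (hH ε)) hε).symm
    _ ≤ ENNReal.ofReal (ε ^ (2 * s)) * eLpNorm (fracGrad s u) 2 volume ^ 2 := by
        rw [eLpNorm_fracGrad_sq]
        gcongr with h
        exact hdiff h

theorem exists_enorm_le_of_slab (hs0 : 0 < s) (hs1 : s < 1) {v : Rn n} (hv : v ≠ 0) :
    ∃ C : ℝ≥0, ∀ {a ε : ℝ} {u : L2 n}, 0 < ε → (∀ᵐ x, x ∉ slab v a ε → u x = 0) →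
      ‖u‖ₑ ≤ C * ENNReal.ofReal (ε ^ s) * eLpNorm (fracGrad s u) 2 volume := by
  have hopen : IsOpen {z : Rn n | 1 < ⟪v, z⟫} := isOpen_lt continuous_const (by fun_prop)
  have hpos : 0 < ∫⁻ z in {z | 1 < ⟪v, z⟫}, fracKernel s z := by
    refine (setLIntegral_pos_iff measurable_fracKernel).mpr ?_
    refine (hopen.measure_pos _ ⟨(2 / ‖v‖ ^ 2) • v, ?_⟩).trans_le
      (measure_mono fun z hz => ⟨(fracKernel_pos hs0 hs1 ?_).ne', hz⟩)
    · rw [Set.mem_ofPred_eq, real_inner_smul_right, real_inner_self_eq_norm_sq,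
        div_mul_cancel₀ _ (by positivity)]
      exact one_lt_two
    · rintro rfl
      simp [zero_le_one.not_gt] at hz
  obtain ⟨c, hc0, hc⟩ := ENNReal.lt_iff_exists_nnreal_btwn.mp hpos
  obtain ⟨d, rfl⟩ : ∃ d : ℝ≥0, d ^ 2 = c := ⟨NNReal.sqrt c, NNReal.sq_sqrt c⟩
  have hd : d ≠ 0 := by
    rintro rfl
    simp at hc0
  refine ⟨d⁻¹, fun {a ε u} hε hu => ?_⟩
  have hle : d * ‖u‖ₑ ≤ ENNReal.ofReal (ε ^ s) * eLpNorm (fracGrad s u) 2 volume := by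
    rw [← ENNReal.pow_le_pow_left_iff two_ne_zero, mul_pow, mul_pow,
      ← ENNReal.ofReal_pow (by positivity), ← Real.rpow_mul_natCast hε.le, mul_comm s,
      Nat.cast_ofNat]
    grw [← lintegral_fracKernel_mul_enorm_sq_le hs0 hs1 hε hu, ← hc.le, ENNReal.coe_pow]
  calc ‖u‖ₑ = (d⁻¹ : ℝ≥0) * (d * ‖u‖ₑ) := by
        rw [← mul_assoc, ← ENNReal.coe_mul, inv_mul_cancel₀ hd, ENNReal.coe_one, one_mul]
    _ ≤ _ := by
        rw [mul_assoc]
        exact mul_le_mul_right hle _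

/-- The fractional Poincaré inequality `‖u‖_{L²} ≤ C ‖∇^s u‖_{L²}` on `H̃^s(Ω)`. -/
def FracPoincare (Ω : Opens (Rn n)) (s : ℝ) : Prop :=
  ∃ C : ℝ≥0, ∀ u : L2 n, MemHsTilde Ω s u → ‖u‖ₑ ≤ C * eLpNorm (fracGrad s u) 2 volume

theorem BoundedInOneDirection.fracPoincare (hs0 : 0 < s) (hs1 : s < 1) {Ω : Opens (Rn n)}
    (hΩ : BoundedInOneDirection (Ω : Set (Rn n))) : FracPoincare Ω s := by
  obtain ⟨v, hv, a, b, hab⟩ := hΩ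
  obtain ⟨C, hC⟩ := exists_enorm_le_of_slab hs0 hs1 (v := v) (norm_ne_zero_iff.mp (by simp [hv]))
  refine ⟨C * ((|b - a| + 1) ^ s).toNNReal, fun u hu => hC (a := a) (by positivity) ?_⟩
  filter_upwards [hu.ae_eq_zero hs0.le] with x hx hxS
  refine hx fun hxΩ => hxS ⟨(hab x hxΩ).1, ?_⟩
  linarith [(hab x hxΩ).2, le_abs_self (b - a)]

theorem BoundedInOneDirection.dim_pos {Ω : Set (Rn n)} (hΩ : BoundedInOneDirection Ω) : 0 < n := by
  obtain ⟨v, hv, -⟩ := hΩ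
  refine Nat.pos_of_ne_zero ?_
  rintro rfl
  simp [Subsingleton.elim v 0] at hv

theorem exists_mem_forall_inner_eq_zero {E F : Type*} [NormedAddCommGroup E] [NormedSpace ℝ E]
    [CompleteSpace E] [NormedAddCommGroup F] [InnerProductSpace ℝ F] [CompleteSpace F]
    {G : Submodule ℝ (E × F)} (hG : IsClosed (G : Set (E × F))) {C : ℝ≥0}
    (hC : ∀ {x z}, (x, z) ∈ G → ‖x‖ ≤ C * ‖z‖) (y : F) : ∃ p ∈ G, ∀ q ∈ G, ⟪y + p.2, q.2⟫ = 0 := by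
  have : CompleteSpace G := hG.completeSpace_coe
  let T : G →L[ℝ] F := (ContinuousLinearMap.snd ℝ E F).comp G.subtypeL
  have hT : AntilipschitzWith (max C 1) T := by
    refine ContinuousLinearMap.antilipschitz_of_bound T fun p => max_le ?_ ?_
    · calc ‖p.1.1‖ ≤ C * ‖p.1.2‖ := hC p.2
        _ ≤ max C 1 * ‖T p‖ := by gcongr; exacts [le_max_left _ _, le_rfl]
    · refine le_mul_of_one_le_left (norm_nonneg _) (le_max_right _ _)
  have : CompleteSpace T.range := (hT.isClosed_range T.uniformContinuous).completeSpace_coe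
  obtain ⟨p, hp⟩ := T.range.starProjection_apply_mem (-y)
  refine ⟨p, p.2, fun q hq => ?_⟩
  have horth := T.range.starProjection_inner_eq_zero (-y) _ ⟨⟨q, hq⟩, rfl⟩
  rw [← hp, ← neg_add', inner_neg_left, neg_eq_zero] at horth
  exact horth

theorem FracPoincare.exists_norm_le (hs0 : 0 < s) (hs1 : s < 1) (hγ : IsConductivity γ)
    {Ω : Opens (Rn n)} (hΩ : FracPoincare Ω s) :
    ∃ C : ℝ≥0, ∀ {u z}, (u, z) ∈ tildeGraph Ω s γ → ‖u‖ ≤ C * ‖z‖ := by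
  obtain ⟨C₁, hC₁⟩ := hΩ
  obtain ⟨C₂, hC₂⟩ := hγ.exists_eLpNorm_condGrad_equiv
  refine ⟨C₁ * C₂, fun {u z} hu => ?_⟩
  obtain ⟨hgraph, htilde⟩ := (mem_tildeGraph_iff hs0 hs1 hγ).mp hu
  have h : ‖u‖ₑ ≤ (C₁ * C₂ : ℝ≥0) * ‖z‖ₑ := by
    grw [hC₁ _ htilde, (hC₂ s u).2, enorm_snd_of_mem_condGraph hgraph, ENNReal.coe_mul, mul_assoc]
  simpa only [enorm_eq_nnnorm, ← ENNReal.coe_mul, ENNReal.coe_le_coe, ← NNReal.coe_le_coe,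
    NNReal.coe_mul, coe_nnnorm] using h

theorem FracPoincare.exists_isWeakSolution (hs0 : 0 < s) (hs1 : s < 1) (hγ : IsConductivity γ)
    {Ω : Opens (Rn n)} (hΩ : FracPoincare Ω s) {f : L2 n} (hf : MemHs s f) :
    ∃ u, IsWeakSolution Ω s γ f u := by
  obtain ⟨C, hC⟩ := hΩ.exists_norm_le hs0 hs1 hγ
  obtain ⟨z, hz⟩ := hf.exists_mem_condGraph hs0 hs1 hγ
  obtain ⟨w, hw, horth⟩ :=
    exists_mem_forall_inner_eq_zero (G := tildeGraph Ω s γ) isClosed_tildeGraph hC z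
  obtain ⟨hgraph, htilde⟩ := (mem_tildeGraph_iff hs0 hs1 hγ).mp hw
  have hsol : (f + w.1, z + w.2) ∈ condGraph s γ := add_mem hz hgraph
  refine ⟨f + w.1, memHs_of_mem_condGraph hs0 hs1 hγ hsol, ?_, fun φ hφ => ?_⟩
  · rwa [add_sub_cancel_left]
  · obtain ⟨q, hq⟩ := hφ.1.exists_mem_condGraph hs0 hs1 hγ
    have hφq : (φ, q) ∈ tildeGraph Ω s γ := (mem_tildeGraph_iff hs0 hs1 hγ).mpr ⟨hq, hφ⟩
    exact (condForm_eq_inner hsol hq).trans (horth _ hφq)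

theorem enorm_sub_mul_enorm_sub_of_disjoint {a a' b b' : ℝ} (h : a = 0 ∨ b = 0)
    (h' : a' = 0 ∨ b' = 0) : ‖a - a'‖ₑ * ‖b - b'‖ₑ = ‖a‖ₑ * ‖b'‖ₑ + ‖b‖ₑ * ‖a'‖ₑ := by
  rcases h with rfl | rfl <;> rcases h' with rfl | rfl <;> simp [mul_comm]

theorem enorm_fracGrad_mul_enorm_fracGrad_le {u v : L2 n} {S₁ S₂ : Set (Rn n)} {δ : ℝ}
    (hδ : 0 < δ) (hsep : ∀ x ∈ S₁, ∀ y ∈ S₂, δ ≤ ‖x - y‖) {p : Rn n × Rn n}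
    (hu₁ : p.1 ∉ S₁ → u p.1 = 0) (hu₂ : p.2 ∉ S₁ → u p.2 = 0)
    (hv₁ : p.1 ∉ S₂ → v p.1 = 0) (hv₂ : p.2 ∉ S₂ → v p.2 = 0) :
    ‖fracGrad s u p‖ₑ * ‖fracGrad s v p‖ₑ ≤
      tailKernel s δ (p.1 - p.2) * (‖u p.1‖ₑ * ‖v p.2‖ₑ + ‖v p.1‖ₑ * ‖u p.2‖ₑ) := by
  have hclose {x y : Rn n} (hxy : ‖x - y‖ < δ) (hx : x ∉ S₁ → u x = 0) (hy : y ∉ S₂ → v y = 0) :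
      u x = 0 ∨ v y = 0 := by
    by_contra! h
    exact (hsep x (by_contra (h.1 <| hx ·)) y (by_contra (h.2 <| hy ·))).not_gt hxy
  have hdisj₁ := hclose (by simpa using hδ) hu₁ hv₁
  have hdisj₂ := hclose (by simpa using hδ) hu₂ hv₂
  rw [enorm_fracGrad, enorm_fracGrad, mul_mul_mul_comm,
    enorm_sub_mul_enorm_sub_of_disjoint hdisj₁ hdisj₂]
  rcases lt_or_ge ‖p.1 - p.2‖ δ with hlt | hge
  · have h₁ := hclose hlt hu₁ hv₂
    have h₂ := hclose (by rwa [norm_sub_rev]) hu₂ hv₁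
    rcases h₁ with h₁ | h₁ <;> rcases h₂ with h₂ | h₂ <;> simp [h₁, h₂]
  · rw [tailKernel_of_le hge, fracKernel, sq, mul_comm]

theorem lintegral_enorm_fracGrad_mul_enorm_fracGrad_le {u v : L2 n} {S₁ S₂ : Set (Rn n)} {δ : ℝ}
    (hδ : 0 < δ) (hsep : ∀ x ∈ S₁, ∀ y ∈ S₂, δ ≤ ‖x - y‖) (hu : ∀ᵐ x, x ∉ S₁ → u x = 0)
    (hv : ∀ᵐ x, x ∉ S₂ → v x = 0) :
    ∫⁻ p, ‖fracGrad s u p‖ₑ * ‖fracGrad s v p‖ₑ ≤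
      2 * (∫⁻ z : Rn n, tailKernel s δ z) * (‖u‖ₑ * ‖v‖ₑ) := by
  have hconv (f g : L2 n) : ∫⁻ p : Rn n × Rn n, tailKernel s δ (p.1 - p.2) *
      (‖f p.1‖ₑ * ‖g p.2‖ₑ) ≤ (∫⁻ z : Rn n, tailKernel s δ z) * (‖f‖ₑ * ‖g‖ₑ) := by
    simp only [Lp.enorm_def]
    exact lintegral_convolution_le measurable_tailKernel (Lp.stronglyMeasurable f)
      (Lp.stronglyMeasurable g)
  calc ∫⁻ p, ‖fracGrad s u p‖ₑ * ‖fracGrad s v p‖ₑ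
      ≤ ∫⁻ p : Rn n × Rn n, (tailKernel s δ (p.1 - p.2) * (‖u p.1‖ₑ * ‖v p.2‖ₑ) +
          tailKernel s δ (p.1 - p.2) * (‖v p.1‖ₑ * ‖u p.2‖ₑ)) := by
        refine lintegral_mono_ae ?_
        filter_upwards [ae_prod_of_ae hu hu, ae_prod_of_ae hv hv] with p hup hvp
        rw [← mul_add]
        exact enorm_fracGrad_mul_enorm_fracGrad_le hδ hsep hup.1 hup.2 hvp.1 hvp.2
    _ ≤ (∫⁻ z : Rn n, tailKernel s δ z) * (‖u‖ₑ * ‖v‖ₑ) +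
          (∫⁻ z : Rn n, tailKernel s δ z) * (‖v‖ₑ * ‖u‖ₑ) := by
        rw [lintegral_add_left (by fun_prop)]
        exact add_le_add (hconv u v) (hconv v u)
    _ = 2 * (∫⁻ z : Rn n, tailKernel s δ z) * (‖u‖ₑ * ‖v‖ₑ) := by ring

theorem IsConductivity.exists_abs_condForm_le_of_separated (hγ : IsConductivity γ)
    (hs0 : 0 < s) (hs1 : s < 1) {δ : ℝ} (hδ : 0 < δ) :
    ∃ K : ℝ≥0, ∀ {u v : L2 n} {S₁ S₂ : Set (Rn n)}, (∀ x ∈ S₁, ∀ y ∈ S₂, δ ≤ ‖x - y‖) →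
      (∀ᵐ x, x ∉ S₁ → u x = 0) → (∀ᵐ x, x ∉ S₂ → v x = 0) →
      |condForm s γ u v| ≤ K * (‖u‖ * ‖v‖) := by
  obtain ⟨C, hC⟩ := hγ.exists_enorm_condGrad_equiv
  obtain ⟨T, hT⟩ : ∃ T : ℝ≥0, (T : ℝ≥0∞) = ∫⁻ z : Rn n, tailKernel s δ z :=
    ⟨_, ENNReal.coe_toNNReal (lintegral_tailKernel_lt_top hs0 hs1 hδ).ne⟩
  refine ⟨C * C * (2 * T), fun {u v S₁ S₂} hsep hu hv => ?_⟩
  have h : ‖condForm s γ u v‖ₑ ≤ (C * C * (2 * T) : ℝ≥0) * (‖u‖ₑ * ‖v‖ₑ) := by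
    calc ‖condForm s γ u v‖ₑ
        ≤ ∫⁻ p, ‖⟪condGrad s γ u p, condGrad s γ v p⟫‖ₑ := by
          rw [condForm_eq_integral_inner_condGrad]
          exact enorm_integral_le_lintegral_enorm _
      _ ≤ ∫⁻ p, C * C * (‖fracGrad s u p‖ₑ * ‖fracGrad s v p‖ₑ) := by
          refine lintegral_mono_ae ?_
          filter_upwards [hC] with p hp
          have hinner : ‖⟪condGrad s γ u p, condGrad s γ v p⟫‖ₑ ≤
              ‖condGrad s γ u p‖ₑ * ‖condGrad s γ v p‖ₑ := by
            simp only [enorm_eq_nnnorm, ← ENNReal.coe_mul, ENNReal.coe_le_coe]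
            exact nnnorm_inner_le_nnnorm _ _
          grw [hinner, (hp s u).1, (hp s v).1, mul_mul_mul_comm]
      _ ≤ (C * C * (2 * T) : ℝ≥0) * (‖u‖ₑ * ‖v‖ₑ) := by
          rw [lintegral_const_mul' _ _ (by finiteness), ENNReal.coe_mul, ENNReal.coe_mul,
            ENNReal.coe_mul, hT, ENNReal.coe_ofNat, mul_assoc (C * C : ℝ≥0∞)]
          gcongr
          exact lintegral_enorm_fracGrad_mul_enorm_fracGrad_le hδ hsep hu hv
  simpa only [enorm_eq_nnnorm, ← ENNReal.coe_mul, ENNReal.coe_le_coe, ← NNReal.coe_le_coe,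
    NNReal.coe_mul, coe_nnnorm, Real.norm_eq_abs] using h

theorem FracPoincare.exists_dnMap_eq (hs0 : 0 < s) (hs1 : s < 1) (hγ : IsConductivity γ)
    {Ω : Opens (Rn n)} (hΩ : FracPoincare Ω s) {f : L2 n} (hf : MemHs s f) :
    ∃ u, IsWeakSolution Ω s γ f u ∧ ∀ g, dnMap Ω s γ f g = condForm s γ u g := by
  have hex := hΩ.exists_isWeakSolution hs0 hs1 hγ hf
  exact ⟨hex.choose, hex.choose_spec, fun g => dif_pos hex⟩

theorem FracPoincare.exists_abs_dnMap_sub_le (hs0 : 0 < s) (hs1 : s < 1) (hγ : IsConductivity γ)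
    {Ω : Opens (Rn n)} (hΩ : FracPoincare Ω s) {S : Set (Rn n)} {δ : ℝ} (hδ : 0 < δ)
    (hsep : ∀ x ∈ (Ω : Set (Rn n)), ∀ y ∈ S, δ ≤ ‖x - y‖) :
    ∃ K : ℝ, ∀ f : L2 n, MemHs s f → (∀ᵐ x, x ∉ S → f x = 0) →
      |dnMap Ω s γ f f - condForm s γ f f| ≤ K * ‖f‖ ^ 2 := by
  obtain ⟨C, hC⟩ := hΩ.exists_norm_le hs0 hs1 hγ
  obtain ⟨K, hK⟩ := hγ.exists_abs_condForm_le_of_separated hs0 hs1 hδ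
  refine ⟨(K * C) ^ 2, fun f hf hfS => ?_⟩
  obtain ⟨u, ⟨-, hw, hu⟩, hdn⟩ := hΩ.exists_dnMap_eq hs0 hs1 hγ hf
  obtain ⟨z, hz⟩ := hf.exists_mem_condGraph hs0 hs1 hγ
  obtain ⟨y, hy⟩ := hw.1.exists_mem_condGraph hs0 hs1 hγ
  have huzy : (u, z + y) ∈ condGraph s γ := by
    simpa only [Prod.mk_add_mk, add_sub_cancel] using add_mem hz hy
  have hdiff : dnMap Ω s γ f f - condForm s γ f f = condForm s γ (u - f) f := by
    rw [hdn, condForm_eq_inner huzy hz, condForm_eq_inner hz hz, condForm_eq_inner hy hz,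
      inner_add_left, add_sub_cancel_left]
  have hweak : condForm s γ (u - f) f = -‖y‖ ^ 2 := by
    have h := hu _ hw
    rw [condForm_eq_inner huzy hy, inner_add_left, real_inner_self_eq_norm_sq] at h
    rw [condForm_eq_inner hy hz, real_inner_comm]
    exact eq_neg_of_add_eq_zero_left h
  have htilde : (u - f, y) ∈ tildeGraph Ω s γ := (mem_tildeGraph_iff hs0 hs1 hγ).mpr ⟨hy, hw⟩
  have hsq : ‖y‖ * ‖y‖ ≤ K * C * ‖f‖ * ‖y‖ := by
    calc ‖y‖ * ‖y‖ = |condForm s γ (u - f) f| := by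
          rw [hweak, abs_neg, abs_of_nonneg (by positivity), sq]
      _ ≤ K * (‖u - f‖ * ‖f‖) := hK hsep (hw.ae_eq_zero hs0.le) hfS
      _ ≤ K * (C * ‖y‖ * ‖f‖) := by
          gcongr
          exact hC htilde
      _ = K * C * ‖f‖ * ‖y‖ := by ring
  have hle : ‖y‖ ≤ K * C * ‖f‖ := by
    rcases (norm_nonneg y).eq_or_lt with h | h
    · rw [← h]
      positivity
    · exact le_of_mul_le_mul_right hsq h
  calc |dnMap Ω s γ f f - condForm s γ f f| = ‖y‖ ^ 2 := by
        rw [hdiff, hweak, abs_neg, abs_of_nonneg (by positivity)]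
    _ ≤ (K * C * ‖f‖) ^ 2 := by gcongr
    _ = (K * C) ^ 2 * ‖f‖ ^ 2 := mul_pow _ _ _

theorem enorm_fracGrad_sq_le_of_far {u : L2 n} {x₀ : Rn n} {r : ℝ} {p : Rn n × Rn n}
    (hu₁ : p.1 ∉ Metric.ball x₀ r → u p.1 = 0) (hu₂ : p.2 ∉ Metric.ball x₀ r → u p.2 = 0)
    (hp : p ∉ Metric.ball (x₀, x₀) (2 * r)) :
    ‖fracGrad s u p‖ₑ ^ 2 ≤ tailKernel s r (p.1 - p.2) * ‖u p.1 - u p.2‖ₑ ^ 2 := by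
  rw [enorm_fracGrad_sq]
  rcases le_or_gt r ‖p.1 - p.2‖ with hle | hlt
  · rw [tailKernel_of_le hle]
  · rw [← dist_eq_norm] at hlt
    rw [Metric.mem_ball, Prod.dist_eq, max_lt_iff, not_and_or, not_lt, not_lt] at hp
    have h₀ : 0 ≤ dist p.1 p.2 := dist_nonneg
    have hp₁ : p.1 ∉ Metric.ball x₀ r := by
      rw [Metric.mem_ball]
      rcases hp with hp | hp <;> linarith [dist_triangle_left p.2 x₀ p.1]
    have hp₂ : p.2 ∉ Metric.ball x₀ r := by
      rw [Metric.mem_ball]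
      rcases hp with hp | hp <;> linarith [dist_triangle p.1 p.2 x₀]
    simp [hu₁ hp₁, hu₂ hp₂]

theorem lintegral_enorm_mul_enorm_fracGrad_sq_le {w : Rn n × Rn n → ℝ} {u : L2 n} {x₀ : Rn n}
    {r : ℝ} {ε M : ℝ≥0} (hε : ∀ p ∈ Metric.ball (x₀, x₀) (2 * r), ‖w p‖ₑ ≤ ε)
    (hM : ∀ᵐ p, ‖w p‖ₑ ≤ M) (hu : ∀ᵐ x, x ∉ Metric.ball x₀ r → u x = 0) :
    ∫⁻ p, ‖w p‖ₑ * ‖fracGrad s u p‖ₑ ^ 2 ≤ ε * eLpNorm (fracGrad s u) 2 volume ^ 2 +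
      M * ((∫⁻ z : Rn n, tailKernel s r z) * (2 * ‖u‖ₑ) ^ 2) := by
  calc ∫⁻ p, ‖w p‖ₑ * ‖fracGrad s u p‖ₑ ^ 2
      ≤ ∫⁻ p, (ε * ‖fracGrad s u p‖ₑ ^ 2 +
          M * (tailKernel s r (p.1 - p.2) * ‖u p.1 - u p.2‖ₑ ^ 2)) := by
        refine lintegral_mono_ae ?_
        filter_upwards [hM, ae_prod_of_ae hu hu] with p hp hup
        by_cases hnear : p ∈ Metric.ball (x₀, x₀) (2 * r)
        · grw [hε p hnear]
          exact le_self_add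
        · grw [hp, enorm_fracGrad_sq_le_of_far hup.1 hup.2 hnear]
          exact le_add_self
    _ = ε * eLpNorm (fracGrad s u) 2 volume ^ 2 +
          M * ∫⁻ p : Rn n × Rn n, tailKernel s r (p.1 - p.2) * ‖u p.1 - u p.2‖ₑ ^ 2 := by
        rw [lintegral_add_right _ (by fun_prop), lintegral_const_mul' _ _ ENNReal.coe_ne_top,
          lintegral_const_mul' _ _ ENNReal.coe_ne_top, eLpNorm_two_sq]
    _ ≤ _ := by
        gcongr
        rw [Lp.enorm_def]
        exact lintegral_mul_enorm_sub_sq_le measurable_tailKernel (Lp.stronglyMeasurable u)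

theorem IsConductivity.nonneg_of_continuousAt (hγ : IsConductivity γ) {x₀ : Rn n}
    (hc : ContinuousAt γ x₀) : 0 ≤ γ x₀ := by
  obtain ⟨a, ha, hae⟩ := hγ.2
  have hfreq : ∃ᶠ x in 𝓝 x₀, 0 ≤ γ x :=
    (mem_closure_iff_frequently.mp (Measure.dense_of_ae hae x₀)).mono fun x hx => ha.le.trans hx
  exact isClosed_Ici.mem_of_frequently_of_tendsto hfreq hc

theorem IsConductivity.tendsto_sqrt_mul_sqrt (hγ : IsConductivity γ) {x₀ : Rn n}
    (hc : ContinuousAt γ x₀) :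
    Tendsto (fun p : Rn n × Rn n => √(γ p.1) * √(γ p.2)) (𝓝 (x₀, x₀)) (𝓝 (γ x₀)) := by
  have h : ContinuousAt (fun p : Rn n × Rn n => √(γ p.1) * √(γ p.2)) (x₀, x₀) :=
    (hc.comp_of_eq continuousAt_fst rfl).sqrt.mul (hc.comp_of_eq continuousAt_snd rfl).sqrt
  simpa only [ContinuousAt, Real.mul_self_sqrt (hγ.nonneg_of_continuousAt hc)] using h

theorem MemHs.memLp_fracGrad (hs0 : 0 < s) (hs1 : s < 1) {u : L2 n} (hu : MemHs s u) :
    MemLp (fracGrad s u) 2 volume := by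
  refine ⟨?_, (memHs_iff hs0 hs1).mp hu⟩
  rw [funext (fracGrad_eq u)]
  exact Measurable.aestronglyMeasurable (by fun_prop)

theorem eLpNorm_two_toReal_sq {α E : Type*} [MeasurableSpace α] [NormedAddCommGroup E]
    {μ : Measure α} {f : α → E} (hf : MemLp f 2 μ) :
    (eLpNorm f 2 μ).toReal ^ 2 = ∫ x, ‖f x‖ ^ 2 ∂μ := by
  rw [← ENNReal.toReal_pow, eLpNorm_two_sq, integral_eq_lintegral_of_nonneg_ae
    (Eventually.of_forall fun x => sq_nonneg _) (hf.1.norm.pow 2)]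
  simp only [ENNReal.ofReal_pow (norm_nonneg _), ofReal_norm]

theorem condForm_self_sub_eq_integral (hs0 : 0 < s) (hs1 : s < 1) (hγ : IsConductivity γ)
    {u : L2 n} (hu : MemHs s u) (c : ℝ) :
    condForm s γ u u - c * (eLpNorm (fracGrad s u) 2 volume).toReal ^ 2 =
      ∫ p : Rn n × Rn n, (√(γ p.1) * √(γ p.2) - c) * ‖fracGrad s u p‖ ^ 2 := by
  have hgrad := hu.memLp_fracGrad hs0 hs1
  have hcond := (hu.memLp_condGrad hs0 hs1 hγ).integrable_norm_pow two_ne_zero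
  have hsq (p : Rn n × Rn n) :
      ‖condGrad s γ u p‖ ^ 2 = √(γ p.1) * √(γ p.2) * ‖fracGrad s u p‖ ^ 2 := by
    rw [condGrad, norm_smul, mul_pow, Real.norm_of_nonneg (by positivity),
      Real.sq_sqrt (by positivity)]
  simp only [hsq] at hcond
  rw [eLpNorm_two_toReal_sq hgrad, ← integral_const_mul]
  simp only [condForm, sub_mul, real_inner_self_eq_norm_sq]
  exact (integral_sub hcond ((hgrad.integrable_norm_pow two_ne_zero).const_mul c)).symm

theorem IsConductivity.exists_enorm_sqrt_mul_sqrt_sub_le (hγ : IsConductivity γ) (c : ℝ) :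
    ∃ M : ℝ≥0, ∀ᵐ p : Rn n × Rn n, ‖√(γ p.1) * √(γ p.2) - c‖ₑ ≤ M := by
  obtain ⟨a, M, -, hbounds⟩ := hγ.exists_bounds
  refine ⟨M + ‖c‖₊, ?_⟩
  filter_upwards [ae_prod_of_ae hbounds hbounds] with p hp
  have hM := (sqrt_mul_sqrt_mem_Icc a.2 hp.1 hp.2).2
  rw [enorm_le_coe]
  grw [nnnorm_sub_le]
  gcongr
  rwa [← NNReal.coe_le_coe, coe_nnnorm, Real.norm_of_nonneg (by positivity)]

theorem IsConductivity.exists_abs_condForm_self_sub_le (hs0 : 0 < s) (hs1 : s < 1)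
    (hγ : IsConductivity γ) {x₀ : Rn n} (hc : ContinuousAt γ x₀) {ε : ℝ} (hε : 0 < ε) :
    ∃ r > 0, ∃ K : ℝ, ∀ u : L2 n, MemHs s u → (∀ᵐ x, x ∉ Metric.ball x₀ r → u x = 0) →
      |condForm s γ u u - γ x₀ * (eLpNorm (fracGrad s u) 2 volume).toReal ^ 2| ≤
        ε * (eLpNorm (fracGrad s u) 2 volume).toReal ^ 2 + K * ‖u‖ ^ 2 := by
  obtain ⟨M, hfar⟩ := hγ.exists_enorm_sqrt_mul_sqrt_sub_le (γ x₀)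
  obtain ⟨r, hr, hnear⟩ := Metric.eventually_nhds_iff_ball.mp
    ((hγ.tendsto_sqrt_mul_sqrt hc).eventually (Metric.closedBall_mem_nhds _ hε))
  lift ε to ℝ≥0 using hε.le
  have hr₂ : 0 < r / 2 := half_pos hr
  obtain ⟨T, hT⟩ : ∃ T : ℝ≥0, (T : ℝ≥0∞) = ∫⁻ z : Rn n, tailKernel s (r / 2) z :=
    ⟨_, ENNReal.coe_toNNReal (lintegral_tailKernel_lt_top hs0 hs1 hr₂).ne⟩
  refine ⟨r / 2, hr₂, M * (T * 4), fun u hu hsupp => ?_⟩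
  obtain ⟨Y, hY⟩ : ∃ Y : ℝ≥0, (Y : ℝ≥0∞) = eLpNorm (fracGrad s u) 2 volume :=
    ⟨_, ENNReal.coe_toNNReal (hu.memLp_fracGrad hs0 hs1).2.ne⟩
  have h : ‖condForm s γ u u - γ x₀ * (eLpNorm (fracGrad s u) 2 volume).toReal ^ 2‖ₑ ≤
      (ε * Y ^ 2 + M * (T * (2 * ‖u‖₊) ^ 2) : ℝ≥0) := by
    rw [condForm_self_sub_eq_integral hs0 hs1 hγ hu]
    grw [enorm_integral_le_lintegral_enorm]
    simp only [enorm_mul, enorm_pow, enorm_norm]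
    grw [lintegral_enorm_mul_enorm_fracGrad_sq_le (ε := ε) (fun p hp => ?_) hfar hsupp, ← hY, ← hT]
    · norm_cast
    · rw [mul_div_cancel₀ _ two_ne_zero] at hp
      simpa [enorm_le_coe, ← NNReal.coe_le_coe, dist_eq_norm] using hnear p hp
  rw [enorm_le_coe, ← NNReal.coe_le_coe, ← hY] at h
  rw [← hY]
  simp only [coe_nnnorm, Real.norm_eq_abs, ENNReal.coe_toReal] at h ⊢
  refine h.trans_eq ?_
  push_cast
  ring

section Reconstruction

variable {W : Opens (Rn n)} {x₀ : Rn n} {φ : ℕ → 𝓓(W, ℝ)}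

theorem norm_testL2 (ψ : 𝓓(W, ℝ)) : ‖testL2 ψ‖ = (eLpNorm ψ 2 volume).toReal := by
  rw [← enorm_testL2, toReal_enorm]

theorem ConcentratesAt.sq_norm_add_sq (hφ : ConcentratesAt s φ x₀) (N : ℕ) :
    ‖testL2 (φ N)‖ ^ 2 + (eLpNorm (fracGrad s (testL2 (φ N))) 2 volume).toReal ^ 2 = 1 := by
  have h := hφ.normalized N
  obtain ⟨h₁, h₂⟩ := ENNReal.add_ne_top.mp (h.trans_ne ENNReal.one_ne_top)
  rw [norm_testL2, ← ENNReal.toReal_pow, ← ENNReal.toReal_pow, ← ENNReal.toReal_add h₁ h₂, h,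
    ENNReal.toReal_one]

theorem ConcentratesAt.tendsto_mul_sq_norm (hφ : ConcentratesAt s φ x₀) (K : ℝ) :
    Tendsto (fun N => K * ‖testL2 (φ N)‖ ^ 2) atTop (𝓝 0) := by
  have h := (ENNReal.tendsto_toReal ENNReal.zero_ne_top).comp hφ.tendsto_zero
  simpa [norm_testL2, Function.comp_def] using (h.pow 2).const_mul K

theorem ConcentratesAt.eventually_ae_eq_zero (hφ : ConcentratesAt s φ x₀) {r : ℝ} (hr : 0 < r) :
    ∀ᶠ N in atTop, ∀ᵐ x, x ∉ Metric.ball x₀ r → testL2 (φ N) x = 0 :=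
  (hφ.support_shrinks r hr).mono fun N hN => testL2_ae_eq_zero (φ N) hN

theorem ConcentratesAt.tendsto_condForm (hs0 : 0 < s) (hs1 : s < 1) (hφ : ConcentratesAt s φ x₀)
    (hγ : IsConductivity γ) (hc : ContinuousAt γ x₀) :
    Tendsto (fun N => condForm s γ (testL2 (φ N)) (testL2 (φ N))) atTop (𝓝 (γ x₀)) := by
  refine Metric.tendsto_nhds.mpr fun ε hε => ?_
  obtain ⟨r, hr, K, hK⟩ := hγ.exists_abs_condForm_self_sub_le hs0 hs1 hc (half_pos hε)
  filter_upwards [hφ.eventually_ae_eq_zero hr,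
    (hφ.tendsto_mul_sq_norm (K + |γ x₀|)).eventually_lt_const (half_pos hε)] with N hsupp hsmall
  have h := hK _ (memHs_testL2 (φ N)) hsupp
  rw [eq_sub_of_add_eq' (hφ.sq_norm_add_sq N)] at h
  rw [Real.dist_eq]
  set B := condForm s γ (testL2 (φ N)) (testL2 (φ N))
  set q := ‖testL2 (φ N)‖ ^ 2
  have hq : 0 ≤ q := sq_nonneg _
  calc |B - γ x₀| = |(B - γ x₀ * (1 - q)) - γ x₀ * q| := by ring_nf
    _ ≤ |B - γ x₀ * (1 - q)| + |γ x₀| * q := by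
        grw [abs_sub, abs_mul, abs_of_nonneg hq]
    _ ≤ ε / 2 * (1 - q) + K * q + |γ x₀| * q := by gcongr
    _ < ε := by nlinarith

theorem exists_separated_ball {Ω : Set (Rn n)} (hx₀ : x₀ ∉ closure Ω) :
    ∃ δ > 0, ∀ x ∈ Ω, ∀ y ∈ Metric.ball x₀ δ, δ ≤ ‖x - y‖ := by
  obtain ⟨d, hd, hball⟩ := Metric.isOpen_iff.mp isClosed_closure.isOpen_compl x₀ hx₀
  refine ⟨d / 2, half_pos hd, fun x hx y hy => ?_⟩
  have hxd : d ≤ dist x x₀ := le_of_not_gt fun hlt => hball hlt (subset_closure hx)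
  rw [Metric.mem_ball] at hy
  rw [← dist_eq_norm]
  linarith [dist_triangle x y x₀]

theorem ConcentratesAt.tendsto_dnMap (hs0 : 0 < s) (hs1 : s < 1) {Ω : Opens (Rn n)}
    (hΩ : FracPoincare Ω s) (hx₀ : x₀ ∉ closure (Ω : Set (Rn n))) (hφ : ConcentratesAt s φ x₀)
    (hγ : IsConductivity γ) (hc : ContinuousAt γ x₀) :
    Tendsto (fun N => dnMap Ω s γ (testL2 (φ N)) (testL2 (φ N))) atTop (𝓝 (γ x₀)) := by
  obtain ⟨δ, hδ, hsep⟩ := exists_separated_ball hx₀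
  obtain ⟨K, hK⟩ := hΩ.exists_abs_dnMap_sub_le hs0 hs1 hγ hδ hsep
  refine (tendsto_iff_of_dist (squeeze_zero' (.of_forall fun _ => dist_nonneg) ?_
    (hφ.tendsto_mul_sq_norm K))).mp (hφ.tendsto_condForm hs0 hs1 hγ hc)
  filter_upwards [hφ.eventually_ae_eq_zero hδ] with N hN
  rw [dist_comm, Real.dist_eq]
  exact hK _ (memHs_testL2 (φ N)) hN

end Reconstruction

section Concentration

variable {W : Opens (Rn n)} {x₀ : Rn n}

theorem exists_testFunction_tsupport_subset (hx₀ : x₀ ∈ W) {S : Set (Rn n)} (hS : S ∈ 𝓝 x₀) :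
    ∃ ψ : 𝓓(W, ℝ), tsupport ψ ⊆ S ∧ ψ x₀ = 1 := by
  obtain ⟨f, hsupp, hcompact, hf, -, hx⟩ := exists_contDiff_tsupport_subset (n := ⊤)
    (inter_mem hS (W.isOpen.mem_nhds hx₀))
  rw [Set.subset_inter_iff] at hsupp
  exact ⟨⟨f, hf, hcompact, hsupp.2⟩, hsupp.1, hx⟩

theorem testL2_ne_zero {ψ : 𝓓(W, ℝ)} (h : ψ x₀ ≠ 0) : testL2 ψ ≠ 0 := by
  intro hzero
  have hae : (ψ : Rn n → ℝ) =ᵐ[volume] 0 := by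
    have := coeFn_testL2 ψ
    rw [hzero] at this
    exact this.symm.trans (Lp.coeFn_zero _ _ _)
  exact h (congrFun ((ψ.continuous.ae_eq_iff_eq volume continuous_zero).mp hae) x₀)

theorem exists_enorm_sq_mul_eq_one {A : ℝ≥0∞} (h0 : A ≠ 0) (htop : A ≠ ⊤) :
    ∃ c : ℝ, ‖c‖ₑ ^ 2 * A = 1 := by
  lift A to ℝ≥0 using htop
  refine ⟨(NNReal.sqrt A)⁻¹, ?_⟩
  rw [ENNReal.coe_ne_zero] at h0
  rw [← NNReal.coe_inv]
  simp only [Real.enorm_eq_ofReal, NNReal.zero_le_coe, ENNReal.ofReal_coe_nnreal]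
  norm_cast
  rw [inv_pow, NNReal.sq_sqrt, inv_mul_cancel₀ h0]

theorem exists_smul_normalized (hs0 : 0 < s) (hs1 : s < 1) {ψ : 𝓓(W, ℝ)} (hψ : testL2 ψ ≠ 0) :
    ∃ c : ℝ, eLpNorm (c • ψ) 2 volume ^ 2 +
      eLpNorm (fracGrad s (testL2 (c • ψ))) 2 volume ^ 2 = 1 := by
  have hgrad := (memHs_iff hs0 hs1).mp (memHs_testL2 (s := s) ψ)
  obtain ⟨c, hc⟩ := exists_enorm_sq_mul_eq_one
    (A := ‖testL2 ψ‖ₑ ^ 2 + eLpNorm (fracGrad s (testL2 ψ)) 2 volume ^ 2)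
    (by simp [hψ]) (by finiteness)
  refine ⟨c, ?_⟩
  have hsmul : testL2 (c • ψ) = c • testL2 ψ := (testL2ₗ W).map_smul c ψ
  rw [← enorm_testL2, hsmul, enorm_smul, eLpNorm_congr_ae (fracGrad_smul c _), eLpNorm_const_smul,
    mul_pow, mul_pow, ← mul_add, hc]

theorem exists_normalized_testFunction (hs0 : 0 < s) (hs1 : s < 1) (hx₀ : x₀ ∈ W) {r : ℝ}
    (hr : 0 < r) : ∃ ψ : 𝓓(W, ℝ), tsupport ψ ⊆ Metric.ball x₀ r ∧
      eLpNorm ψ 2 volume ^ 2 + eLpNorm (fracGrad s (testL2 ψ)) 2 volume ^ 2 = 1 := by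
  obtain ⟨ψ, hsupp, hψ⟩ := exists_testFunction_tsupport_subset hx₀ (Metric.ball_mem_nhds x₀ hr)
  obtain ⟨c, hc⟩ := exists_smul_normalized hs0 hs1 (testL2_ne_zero (hψ.trans_ne one_ne_zero))
  exact ⟨c • ψ, (closure_mono (Function.support_const_smul_subset c ψ)).trans hsupp, hc⟩

theorem ball_subset_slab {v : Rn n} (hv : ‖v‖ = 1) (r : ℝ) :
    Metric.ball x₀ r ⊆ slab v (⟪v, x₀⟫ - r) (2 * r) := by
  intro x hx
  have h : |⟪v, x⟫ - ⟪v, x₀⟫| ≤ r := by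
    rw [← inner_sub_right]
    grw [abs_real_inner_le_norm, hv, one_mul, mem_ball_iff_norm.mp hx]
  rw [abs_le] at h
  exact ⟨by linarith, by linarith⟩

theorem exists_enorm_le_of_ball (hn : 0 < n) (hs0 : 0 < s) (hs1 : s < 1) :
    ∃ C : ℝ≥0, ∀ {x₀ : Rn n} {r : ℝ} {u : L2 n}, 0 < r →
      (∀ᵐ x, x ∉ Metric.ball x₀ r → u x = 0) →
      ‖u‖ₑ ≤ C * ENNReal.ofReal ((2 * r) ^ s) * eLpNorm (fracGrad s u) 2 volume := by
  have : Nonempty (Fin n) := ⟨⟨0, hn⟩⟩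
  obtain ⟨v, hv⟩ := exists_norm_eq (Rn n) zero_le_one
  obtain ⟨C, hC⟩ := exists_enorm_le_of_slab hs0 hs1 (norm_ne_zero_iff.mp (hv.trans_ne one_ne_zero))
  exact ⟨C, fun hr hu => hC (by positivity)
    (hu.mono fun x hx hslab => hx fun hball => hslab (ball_subset_slab hv _ hball))⟩

theorem exists_concentratesAt (hn : 0 < n) (hs0 : 0 < s) (hs1 : s < 1) (hx₀ : x₀ ∈ W) :
    ∃ φ : ℕ → 𝓓(W, ℝ), ConcentratesAt s φ x₀ := by
  have hr (N : ℕ) : (0 : ℝ) < 1 / (N + 1) := Nat.one_div_pos_of_nat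
  have hr₀ : Tendsto (fun N : ℕ => 1 / ((N : ℝ) + 1)) atTop (𝓝 0) :=
    tendsto_one_div_add_atTop_nhds_zero_nat
  choose φ hsupp hnorm using fun N => exists_normalized_testFunction hs0 hs1 hx₀ (hr N)
  refine ⟨φ, hnorm, ?_, fun ε hε => ?_⟩
  · obtain ⟨C, hC⟩ := exists_enorm_le_of_ball hn hs0 hs1
    have hbound (N : ℕ) :
        eLpNorm (φ N) 2 volume ≤ C * ENNReal.ofReal ((2 * (1 / ((N : ℝ) + 1))) ^ s) := by
      have hgrad : eLpNorm (fracGrad s (testL2 (φ N))) 2 volume ≤ 1 :=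
        (pow_le_one_iff two_ne_zero).mp (le_add_self.trans_eq (hnorm N))
      rw [← enorm_testL2]
      grw [hC (hr N) (testL2_ae_eq_zero (φ N) (hsupp N)), hgrad, mul_one]
    refine tendsto_of_tendsto_of_tendsto_of_le_of_le tendsto_const_nhds ?_
      (fun _ => zero_le) hbound
    have hpow := ENNReal.tendsto_ofReal ((hr₀.const_mul 2).rpow_const (Or.inr hs0.le))
    simpa [Real.zero_rpow hs0.ne'] using
      ENNReal.Tendsto.const_mul hpow (Or.inr (ENNReal.coe_ne_top (r := C)))
  · filter_upwards [hr₀.eventually_lt_const hε] with N hN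
    exact (hsupp N).trans (Metric.ball_subset_ball hN.le)

end Concentration

theorem eq_of_dnMap_eq (hn : 0 < n) (hs0 : 0 < s) (hs1 : s < 1) {Ω W : Opens (Rn n)}
    (hΩ : FracPoincare Ω s) (hWΩ : (W : Set (Rn n)) ⊆ (closure (Ω : Set (Rn n)))ᶜ)
    {γ₁ γ₂ : Rn n → ℝ} (hγ₁ : IsConductivity γ₁) (hγ₂ : IsConductivity γ₂)
    (heq : ∀ f : 𝓓(W, ℝ), dnMap Ω s γ₁ (testL2 f) (testL2 f) =
      dnMap Ω s γ₂ (testL2 f) (testL2 f))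
    {x : Rn n} (hx : x ∈ W) (hc₁ : ContinuousAt γ₁ x) (hc₂ : ContinuousAt γ₂ x) :
    γ₁ x = γ₂ x := by
  obtain ⟨φ, hφ⟩ := exists_concentratesAt hn hs0 hs1 hx
  refine tendsto_nhds_unique (hφ.tendsto_dnMap hs0 hs1 hΩ (hWΩ hx) hγ₁ hc₁) ?_
  simpa only [heq] using hφ.tendsto_dnMap hs0 hs1 hΩ (hWΩ hx) hγ₂ hc₂

end FracCond

open FracCond in
theorem theorem3p2_general {n : ℕ} {s : ℝ} (hn : 0 < n) (hs0 : 0 < s) (hs1 : s < 1)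
    {Ω W : Opens (Rn n)} (hΩ : FracPoincare Ω s)
    (hWΩ : (W : Set (Rn n)) ⊆ (closure (Ω : Set (Rn n)))ᶜ) :
    (∀ γ₁ γ₂ : Rn n → ℝ, IsConductivity γ₁ → IsConductivity γ₂ →
      (∀ᵐ x ∂(volume.restrict (W : Set (Rn n))), ContinuousAt γ₁ x) →
      (∀ᵐ x ∂(volume.restrict (W : Set (Rn n))), ContinuousAt γ₂ x) →
      (∀ f : 𝓓(W, ℝ),
        dnMap Ω s γ₁ (testL2 f) (testL2 f) = dnMap Ω s γ₂ (testL2 f) (testL2 f)) →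
      γ₁ =ᵐ[volume.restrict (W : Set (Rn n))] γ₂) ∧
    (∃ φ : Rn n → ℕ → 𝓓(W, ℝ), ∀ x₀ ∈ W,
      ConcentratesAt s (φ x₀) x₀ ∧
      ∀ γ : Rn n → ℝ, IsConductivity γ → ContinuousAt γ x₀ →
        Tendsto (fun N => dnMap Ω s γ (testL2 (φ x₀ N)) (testL2 (φ x₀ N))) atTop (𝓝 (γ x₀))) := by
  constructor
  · intro γ₁ γ₂ hγ₁ hγ₂ hc₁ hc₂ heq
    filter_upwards [hc₁, hc₂, ae_restrict_mem W.isOpen.measurableSet] with x hx₁ hx₂ hx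
    exact eq_of_dnMap_eq hn hs0 hs1 hΩ hWΩ hγ₁ hγ₂ heq hx hx₁ hx₂
  · choose! φ hφ using fun x₀ (hx₀ : x₀ ∈ W) => exists_concentratesAt hn hs0 hs1 hx₀
    exact ⟨φ, fun x₀ hx₀ => ⟨hφ x₀ hx₀, fun γ hγ hc =>
      (hφ x₀ hx₀).tendsto_dnMap hs0 hs1 hΩ (hWΩ hx₀) hγ hc⟩⟩

open FracCond in
theorem theorem3p2 (n : ℕ) (s : ℝ) (hs0 : 0 < s) (hs1 : s < 1)
    (Ω : Opens (Rn n)) (hΩ : BoundedInOneDirection (Ω : Set (Rn n)))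
    (W : Opens (Rn n)) (hW : (W : Set (Rn n)).Nonempty)
    (hWΩ : (W : Set (Rn n)) ⊆ (closure (Ω : Set (Rn n)))ᶜ) :
    -- exterior determination
    (∀ γ₁ γ₂ : Rn n → ℝ, IsConductivity γ₁ → IsConductivity γ₂ →
      (∀ᵐ x ∂(volume.restrict (W : Set (Rn n))), ContinuousAt γ₁ x) →
      (∀ᵐ x ∂(volume.restrict (W : Set (Rn n))), ContinuousAt γ₂ x) →
      (∀ f g : 𝓓(W, ℝ),
        dnMap Ω s γ₁ (testL2 f) (testL2 g) = dnMap Ω s γ₂ (testL2 f) (testL2 g)) →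
      γ₁ =ᵐ[volume.restrict (W : Set (Rn n))] γ₂) ∧
    -- reconstruction, with test functions that do not depend on the conductivity
    (∃ φ : Rn n → ℕ → 𝓓(W, ℝ), ∀ x₀ ∈ W,
      ConcentratesAt s (φ x₀) x₀ ∧
      ∀ γ : Rn n → ℝ, IsConductivity γ → ContinuousAt γ x₀ →
        Tendsto (fun N => dnMap Ω s γ (testL2 (φ x₀ N)) (testL2 (φ x₀ N))) atTop (𝓝 (γ x₀))) := by
  obtain ⟨hdet, hrec⟩ := theorem3p2_general hΩ.dim_pos hs0 hs1 (hΩ.fracPoincare hs0 hs1) hWΩ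
  exact ⟨fun γ₁ γ₂ hγ₁ hγ₂ hc₁ hc₂ heq => hdet γ₁ γ₂ hγ₁ hγ₂ hc₁ hc₂ fun f => heq f f, hrec⟩
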